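/- Let $N\ge 1$ be an integer, let $\lambda_1<\lambda_2<\dots<\lambda_N$ be real numbers and let $a_1,\dots,a_N$ be complex numbers. Put $\phi(t)=\sum_{k=1}^N a_k e^{2i\pi\lambda_k t}$ for $t\in\mathbb R$. Then the limit $L=\lim_{T\to+\infty}\frac1T\int_{-T/2}^{T/2}|\phi(t)|\,dt$ exists and is finite, and: (i) $\displaystyle L\ \ge\ \frac1{26}\sum_{k=1}^N\frac{|a_k|}{k+1}$. (ii) If $|a_k|\ge 1$ for every $k=1,\dots,N$, then $\displaystyle L\ \ge\ \frac{4}{\pi^3}\ln N$. (iii) If $|\lambda_k-\lambda_\ell|\ge|k-\ell|$ for all $k,\ell=1,\dots,N$ (with no lower bound on the $|a_k|$ assumed), then for every real $T\ge 72$, $$\frac1T\int_{-T/2}^{T/2}|\phi(t)|\,dt\ \ge\ \frac1{122}\sum_{k=1}^N\frac{|a_k|}{k+1}.$$ -/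

import Mathlib

/-- The non-harmonic trigonometric polynomial `t ↦ ∑_{k=1}^N a_k e^{2 i π λ_k t}`. -/
noncomputable def trigPoly (N : ℕ) (freq : ℕ → ℝ) (a : ℕ → ℂ) (t : ℝ) : ℂ :=
  ∑ k ∈ Finset.Icc 1 N, a k * Complex.exp (2 * Complex.I * (Real.pi : ℂ) * (freq k : ℂ) * (t : ℂ))

/-- The mean `(1/T) ∫_{-T/2}^{T/2} |f(t)| dt` of the modulus of `f` over the centred interval of
length `T`. -/
noncomputable def absMean (f : ℝ → ℂ) (T : ℝ) : ℝ :=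
  (1 / T) * ∫ t in (-(T / 2))..(T / 2), ‖f t‖

/-!
The proof is the McGehee–Pigno–Smith proof of the Littlewood conjecture, with constants followed
closely and with a weight that makes it work on bounded intervals.

The mean over `[-T/2, T/2]` is rescaled to an integral over `[-1/2, 1/2]`. Indices are split into
consecutive blocks `D₀, D₁, …` of sizes `1, r, r², …`, and the `L¹` norm of `φ = ∑ aₖ e(μₖ s)` is
bounded below by `|∫ φ F| / ‖F‖_∞`, where `F` is built from the normalised conjugate blocks
`gⱼ = w(s) r⁻ʲ ∑_{l ∈ Dⱼ} u_l e(-μ_l s)` by `F₀ = g₀`, `Fⱼ₊₁ = Fⱼ exp(-ε hⱼ₊₁) + gⱼ₊₁`. Here `hⱼ` is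
a polynomial in `e(s)` with `Re hⱼ ≥ |gⱼ|`, which keeps `|F| ≤ 1 / (1 - e^{-ε})`
(`norm_testFun_le`), and `‖hⱼ‖₂² ≤ 2 ‖gⱼ‖₂²` up to an arbitrarily small error (`exists_damping`).
For `k` in the block `Dₘ`, the pairing of `e(μₖ s)` with the damped `gⱼ` is

* negligible for `j < m`, because the damping factor only adds nonnegative integer frequencies to
  the positive numbers `μₖ - μ_l`;
* for `j ≥ m`, within `O(‖gⱼ‖₂ ∑_{i > j} ‖hᵢ‖₂)` of the undamped pairing, which is `r⁻ᵐ ∫ w` up to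
  a phase if `j = m` and negligible otherwise.

This is `weighted_lower_bound`. It is used in two situations. For integer frequencies and `w = 1`
the negligible terms vanish, and `r = 4` or `r = 81` give the two lower bounds
`integer_sum_div_le` and `integer_log_le`. For frequencies separated by `72` and `w = cos² (πs)`
they are bounded by means of the cubic decay of the Fourier transform of `w`
(`separated_sum_div_le`).

Finally, the limit of the means exists because `|φ|` is a uniform limit of trigonometric polynomials
(`exists_tendsto_absMean`). Simultaneous Diophantine approximation provides arbitrarily large `T`
for which all `T * freq k` are almost integers, so that lower bounds for integer frequencies pass
to the limit (`le_of_tendsto_absMean`).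
-/

namespace Littlewood

open Finset intervalIntegral

/-! ### The characters `x ↦ e^{2πix}` and their integrals -/

/-- The additive character `x ↦ e^{2πix}` of the real line. -/
noncomputable def ch (x : ℝ) : ℂ := Complex.exp ((2 * Real.pi * x : ℝ) * Complex.I)

lemma ch_zero : ch 0 = 1 := by simp [ch]

lemma ch_add (x y : ℝ) : ch (x + y) = ch x * ch y := by
  rw [ch, ch, ch, ← Complex.exp_add]; congr 1; push_cast; ring

lemma norm_ch (x : ℝ) : ‖ch x‖ = 1 := Complex.norm_exp_ofReal_mul_I _

lemma ch_neg (x : ℝ) : ch (-x) = (starRingEnd ℂ) (ch x) := by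
  rw [ch, ch, ← Complex.exp_conj, map_mul, Complex.conj_ofReal, Complex.conj_I]
  congr 1; push_cast; ring

lemma ch_nat_mul (n : ℕ) (x : ℝ) : ch (n * x) = ch x ^ n := by
  rw [ch, ch, ← Complex.exp_nat_mul]; congr 1; push_cast; ring

lemma ch_int (n : ℤ) : ch n = 1 := by
  rw [ch, Complex.exp_eq_one_iff]; exact ⟨n, by push_cast; ring⟩

@[fun_prop]
lemma continuous_ch : Continuous ch := by unfold ch; fun_prop

lemma norm_ch_sub_one_le (x : ℝ) : ‖ch x - 1‖ ≤ 2 * Real.pi * |x| := by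
  have := Real.norm_exp_I_mul_ofReal_sub_one_le (x := 2 * Real.pi * x)
  rw [ch, mul_comm]
  refine this.trans (le_of_eq ?_)
  rw [Real.norm_eq_abs, abs_mul, abs_of_pos (by positivity : 0 < 2 * Real.pi)]

lemma integral_ch_mul {x : ℝ} (hx : x ≠ 0) (a : ℝ) :
    ∫ s in (-a)..a, ch (x * s) = ((Real.sin (2 * Real.pi * x * a) / (Real.pi * x) : ℝ) : ℂ) := by
  have hc : (2 * Real.pi * x * Complex.I : ℂ) ≠ 0 := by
    have : (x : ℂ) ≠ 0 := by exact_mod_cast hx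
    simp [Real.pi_ne_zero, this]
  have h1 : ∀ s : ℝ, ch (x * s) = Complex.exp ((2 * Real.pi * x * Complex.I : ℂ) * s) := by
    intro s; rw [ch]; congr 1; push_cast; ring
  simp_rw [h1]
  rw [integral_exp_mul_complex hc]
  push_cast
  rw [Complex.sin]
  have hx' : (x : ℂ) ≠ 0 := by exact_mod_cast hx
  have hp : (Real.pi : ℂ) ≠ 0 := by exact_mod_cast Real.pi_ne_zero
  have e1 : (2 * Real.pi * x * Complex.I : ℂ) * a = 2 * Real.pi * x * a * Complex.I := by ring
  have e2 : (2 * Real.pi * x * Complex.I : ℂ) * -a = -(2 * Real.pi * x * a) * Complex.I := by ring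
  rw [e1, e2]
  field_simp
  rw [Complex.I_sq]
  ring

lemma integral_ch_int {n : ℤ} (hn : n ≠ 0) :
    ∫ s in (-(1 / 2) : ℝ)..(1 / 2), ch (n * s) = 0 := by
  rw [integral_ch_mul (by exact_mod_cast hn)]
  have : 2 * Real.pi * (n : ℝ) * (1 / 2) = n * Real.pi := by ring
  rw [this, Real.sin_int_mul_pi]; simp

/-- Integration against a continuous weight commutes with the expansion of a polynomial in
`ch s`. -/
lemma integral_mul_polynomial_ch {w : ℝ → ℂ} (hw : Continuous w) (P : Polynomial ℂ) :
    ∫ s in (-(1 / 2) : ℝ)..(1 / 2), w s * P.eval (ch s) =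
      ∑ n ∈ range (P.natDegree + 1),
        P.coeff n * ∫ s in (-(1 / 2) : ℝ)..(1 / 2), w s * ch (n * s) := by
  simp_rw [Polynomial.eval_eq_sum_range, mul_sum]
  rw [intervalIntegral.integral_finsetSum]
  · refine sum_congr rfl fun n _ => ?_
    rw [← intervalIntegral.integral_const_mul]
    congr 1; ext s; rw [ch_nat_mul]; ring
  · intro n _
    exact (by fun_prop : Continuous _).intervalIntegrable _ _

lemma integral_polynomial_ch_mul_ch (P : Polynomial ℂ) (n : ℕ) :
    ∫ s in (-(1 / 2) : ℝ)..(1 / 2), ch (-(n * s)) * P.eval (ch s) = P.coeff n := by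
  rw [integral_mul_polynomial_ch (by fun_prop)]
  have key : ∀ m : ℕ, ∫ s in (-(1 / 2) : ℝ)..(1 / 2), ch (-(n * s)) * ch (m * s) =
      if m = n then 1 else 0 := by
    intro m
    have : ∀ s : ℝ, ch (-(n * s)) * ch (m * s) = ch (((m - n : ℤ) : ℝ) * s) := by
      intro s; rw [← ch_add]; congr 1; push_cast; ring
    simp_rw [this]
    split_ifs with h
    · subst h; norm_num [ch_zero]
    · exact integral_ch_int (by omega)
  simp_rw [key]
  simp only [mul_ite, mul_one, mul_zero, sum_ite_eq', mem_range]
  split_ifs with h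
  · rfl
  · exact (Polynomial.coeff_eq_zero_of_natDegree_lt (by omega)).symm

lemma norm_coeff_le {P : Polynomial ℂ} {M : ℝ}
    (hP : ∀ s ∈ Set.Icc (-(1 / 2) : ℝ) (1 / 2), ‖P.eval (ch s)‖ ≤ M) (n : ℕ) :
    ‖P.coeff n‖ ≤ M := by
  rw [← integral_polynomial_ch_mul_ch P n]
  refine (intervalIntegral.norm_integral_le_of_norm_le_const (C := M) fun s hs => ?_).trans ?_
  · rw [norm_mul, norm_ch, one_mul]
    rw [Set.uIoc_of_le (by norm_num)] at hs
    exact hP s ⟨hs.1.le, hs.2⟩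
  · norm_num

/-- A polynomial with real constant term, viewed as an analytic function on the unit circle, has
an imaginary part of `L²` norm at most that of its real part, since its square has the
nonnegative mean `(h.coeff 0)²`. -/
lemma integral_norm_sq_le {h : Polynomial ℂ} (h0 : (h.coeff 0).im = 0) :
    ∫ s in (-(1 / 2) : ℝ)..(1 / 2), ‖h.eval (ch s)‖ ^ 2 ≤
      2 * ∫ s in (-(1 / 2) : ℝ)..(1 / 2), (h.eval (ch s)).re ^ 2 := by
  have hc : Continuous fun s : ℝ => h.eval (ch s) := by fun_prop
  have h1 := integral_polynomial_ch_mul_ch (h * h) 0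
  simp only [Nat.cast_zero, zero_mul, neg_zero, ch_zero, one_mul, Polynomial.mul_coeff_zero] at h1
  have h2 : 0 ≤ ∫ s in (-(1 / 2) : ℝ)..(1 / 2), ((h * h).eval (ch s)).re := by
    have := Complex.reCLM.intervalIntegral_comp_comm
      (μ := MeasureTheory.volume) (a := -(1 / 2)) (b := 1 / 2) (f := fun s => (h * h).eval (ch s))
      ((by fun_prop : Continuous _).intervalIntegrable _ _)
    simp only [Complex.reCLM_apply] at this
    rw [this, h1, Complex.mul_re, h0]
    nlinarith [mul_self_nonneg (h.coeff 0).re]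
  have h3 : ∀ s : ℝ, ‖h.eval (ch s)‖ ^ 2 =
      2 * (h.eval (ch s)).re ^ 2 - ((h * h).eval (ch s)).re := by
    intro s
    rw [Complex.sq_norm, Complex.normSq_apply, Polynomial.eval_mul, Complex.mul_re]; ring
  simp_rw [h3]
  rw [intervalIntegral.integral_sub, intervalIntegral.integral_const_mul]
  · linarith
  · exact (by fun_prop : Continuous _).intervalIntegrable _ _
  · exact (by fun_prop : Continuous _).intervalIntegrable _ _

lemma integral_mul_le_of_sq_le {f g : ℝ → ℝ} (hf : Continuous f) (hg : Continuous g) {A B : ℝ}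
    (hA : 0 < A) (hB : 0 < B)
    (hfA : ∫ s in (-(1 / 2) : ℝ)..(1 / 2), f s ^ 2 ≤ A ^ 2)
    (hgB : ∫ s in (-(1 / 2) : ℝ)..(1 / 2), g s ^ 2 ≤ B ^ 2) :
    ∫ s in (-(1 / 2) : ℝ)..(1 / 2), f s * g s ≤ A * B := by
  have h1 : ∫ s in (-(1 / 2) : ℝ)..(1 / 2), f s * g s ≤
      ∫ s in (-(1 / 2) : ℝ)..(1 / 2), (B / (2 * A) * f s ^ 2 + A / (2 * B) * g s ^ 2) := by
    refine intervalIntegral.integral_mono_on (by norm_num)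
      ((by fun_prop : Continuous _).intervalIntegrable _ _)
      ((by fun_prop : Continuous _).intervalIntegrable _ _) fun s _ => ?_
    have : B / (2 * A) * f s ^ 2 + A / (2 * B) * g s ^ 2 - f s * g s =
        (B * f s - A * g s) ^ 2 / (2 * A * B) := by field_simp; ring
    have h2 : 0 ≤ (B * f s - A * g s) ^ 2 / (2 * A * B) := by positivity
    linarith
  rw [intervalIntegral.integral_add ((by fun_prop : Continuous _).intervalIntegrable _ _)
      ((by fun_prop : Continuous _).intervalIntegrable _ _), intervalIntegral.integral_const_mul,
      intervalIntegral.integral_const_mul] at h1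
  calc _ ≤ _ := h1
    _ ≤ B / (2 * A) * A ^ 2 + A / (2 * B) * B ^ 2 := by gcongr
    _ = A * B := by field_simp; ring

/-! ### Analytic polynomials with prescribed real part -/

/-- Every trigonometric polynomial has the same real part as a polynomial in `e^{2πis}` with real
constant term. -/
lemma exists_polynomial_re_eq {τ : C(AddCircle (1 : ℝ), ℂ)}
    (hτ : τ ∈ Submodule.span ℂ (Set.range (@fourier (1 : ℝ)))) :
    ∀ c : ℂ, ∃ h : Polynomial ℂ, (h.coeff 0).im = 0 ∧
      ∀ s : ℝ, (h.eval (ch s)).re = (c * τ (s : AddCircle (1 : ℝ))).re := by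
  induction hτ using Submodule.span_induction with
  | mem x hx =>
    obtain ⟨n, rfl⟩ := hx
    intro c
    have hf : ∀ s : ℝ, fourier n (s : AddCircle (1 : ℝ)) = ch (n * s) := by
      intro s; rw [fourier_coe_apply, ch]; congr 1; push_cast; ring
    simp_rw [hf]
    rcases lt_trichotomy n 0 with hn | hn | hn
    · refine ⟨Polynomial.C ((starRingEnd ℂ) c) * Polynomial.X ^ n.natAbs, ?_, fun s => ?_⟩
      · rw [Polynomial.coeff_C_mul_X_pow, if_neg (by omega)]; rfl
      · have : (n : ℝ) * s = -(n.natAbs * s) := by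
          rw [Nat.cast_natAbs, abs_of_neg hn]; push_cast; ring
        rw [this, ch_neg, ch_nat_mul, ← Complex.conj_re]
        simp
    · subst hn
      refine ⟨Polynomial.C (c.re : ℂ), by simp, fun s => ?_⟩
      simp [ch_zero]
    · refine ⟨Polynomial.C c * Polynomial.X ^ n.natAbs, ?_, fun s => ?_⟩
      · rw [Polynomial.coeff_C_mul_X_pow, if_neg (by omega)]; rfl
      · have : (n : ℝ) * s = n.natAbs * s := by
          rw [Nat.cast_natAbs, abs_of_pos hn]
        rw [this, ch_nat_mul]
        simp
  | zero => exact fun c => ⟨0, by simp, by simp⟩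
  | add x y _ _ hx hy =>
    intro c
    obtain ⟨h, h0, h1⟩ := hx c
    obtain ⟨k, k0, k1⟩ := hy c
    refine ⟨h + k, by simp [h0, k0], fun s => ?_⟩
    rw [Polynomial.eval_add, Complex.add_re, h1, k1, ← Complex.add_re, ← mul_add]; rfl
  | smul a x _ hx =>
    intro c
    obtain ⟨h, h0, h1⟩ := hx (c * a)
    refine ⟨h, h0, fun s => ?_⟩
    rw [h1, mul_assoc]; rfl

/-- A real function on the unit circle is dominated, as closely as desired, by the real part of a
polynomial with real constant term. -/
lemma exists_polynomial_re_approx {g : ℝ → ℝ} (hg : Continuous g)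
    (hper : g (-(1 / 2)) = g (1 / 2)) {δ : ℝ} (hδ : 0 < δ) :
    ∃ h : Polynomial ℂ, (h.coeff 0).im = 0 ∧ ∀ s ∈ Set.Icc (-(1 / 2) : ℝ) (1 / 2),
      g s ≤ (h.eval (ch s)).re ∧ (h.eval (ch s)).re ≤ g s + δ := by
  let G : ℝ → ℂ := fun s => ((g s + δ / 2 : ℝ) : ℂ)
  have hG : Continuous G := by fun_prop
  have hGc : Continuous (AddCircle.liftIco (1 : ℝ) (-(1 / 2)) G) := by
    refine AddCircle.liftIco_continuous ?_ hG.continuousOn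
    simp only [G]; rw [hper]; norm_num
  have hmem : (⟨_, hGc⟩ : C(AddCircle (1 : ℝ), ℂ)) ∈
      (Submodule.span ℂ (Set.range (@fourier (1 : ℝ)))).topologicalClosure := by
    rw [span_fourier_closure_eq_top]; trivial
  rw [← SetLike.mem_coe, Submodule.topologicalClosure_coe, Metric.mem_closure_iff] at hmem
  obtain ⟨τ, hτ, hd⟩ := hmem (δ / 2) (by positivity)
  obtain ⟨h, h0, h1⟩ := exists_polynomial_re_eq hτ 1
  have key : ∀ s ∈ Set.Ico (-(1 / 2) : ℝ) (1 / 2),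
      g s ≤ (h.eval (ch s)).re ∧ (h.eval (ch s)).re ≤ g s + δ := by
    intro s hs
    have h2 := (ContinuousMap.dist_apply_le_dist (s : AddCircle (1 : ℝ))).trans hd.le
    rw [ContinuousMap.coe_mk, AddCircle.liftIco_coe_apply (by norm_num; norm_num at hs; exact hs),
      dist_eq_norm] at h2
    have h3 := (Complex.abs_re_le_norm _).trans h2
    have h4 := h1 s
    rw [one_mul] at h4
    rw [Complex.sub_re, ← h4, Complex.ofReal_re, abs_le] at h3
    constructor <;> linarith [h3.1, h3.2]
  refine ⟨h, h0, fun s hs => ?_⟩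
  rcases eq_or_lt_of_le hs.2 with he | hlt
  · have hch : ch (1 / 2) = ch (-(1 / 2)) := by
      have := ch_add (-(1 / 2)) ((1 : ℤ) : ℝ)
      rw [ch_int, mul_one] at this
      rw [← this]; norm_num
    rw [he, hch, ← hper]
    exact key _ ⟨le_rfl, by norm_num⟩
  · exact key s ⟨hs.1, hlt⟩

/-! ### Exponentials of analytic polynomials -/

lemma norm_exp_sub_one_le_of_re_nonpos {z : ℂ} (hz : z.re ≤ 0) : ‖Complex.exp z - 1‖ ≤ ‖z‖ := by
  have := Convex.norm_image_sub_le_of_norm_deriv_le (𝕜 := ℂ) (f := Complex.exp)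
    (s := {z : ℂ | z.re ≤ 0}) (C := 1) (x := 0) (y := z)
    (fun x _ => Complex.differentiableAt_exp)
    (fun x hx => by
      rw [Complex.deriv_exp, Complex.norm_exp]
      exact Real.exp_le_one_iff.mpr hx)
    (convex_halfSpace_re_le 0) (by simp) hz
  simpa using this

/-- Uniform approximation of `exp ∘ Q` on the arc by polynomials. -/
lemma exists_polynomial_exp_approx (Q : Polynomial ℂ) {η : ℝ} (hη : 0 < η) :
    ∃ P : Polynomial ℂ, ∀ s ∈ Set.Icc (-(1 / 2) : ℝ) (1 / 2),
      ‖Complex.exp (Q.eval (ch s)) - P.eval (ch s)‖ ≤ η := by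
  have hc : Continuous fun s : ℝ => Q.eval (ch s) := by fun_prop
  obtain ⟨R, hR⟩ := (isCompact_Icc (a := (-(1 / 2) : ℝ)) (b := 1 / 2)).exists_bound_of_continuousOn
    hc.continuousOn
  have h1 := ((FloorSemiring.tendsto_pow_div_factorial_atTop (max R 0)).mul_const 2).eventually
    (gt_mem_nhds (by simpa using hη))
  have h2 : ∀ᶠ n : ℕ in Filter.atTop, max R 0 ≤ n / 2 := by
    filter_upwards [Filter.eventually_ge_atTop ⌈2 * max R 0⌉₊] with n hn
    have := (Nat.le_ceil _).trans (Nat.cast_le (α := ℝ).mpr hn)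
    linarith
  obtain ⟨n, hn1, hn2⟩ := (h1.and h2).exists
  refine ⟨∑ m ∈ range n, Polynomial.C ((m.factorial : ℂ)⁻¹) * Q ^ m, fun s hs => ?_⟩
  have hs' : ‖Q.eval (ch s)‖ ≤ max R 0 := (hR s hs).trans (le_max_left _ _)
  have h3 := Complex.exp_bound' (x := Q.eval (ch s)) (n := n) (by
    rw [div_le_iff₀ (by positivity)]; push_cast; linarith)
  rw [Polynomial.eval_finsetSum]
  simp only [Polynomial.eval_mul, Polynomial.eval_C, Polynomial.eval_pow]
  simp only [div_eq_inv_mul (_ ^ _)] at h3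
  refine h3.trans (le_trans ?_ hn1.le)
  rw [← div_eq_inv_mul]
  gcongr

/-- A bound for integrals against polynomials bounded by `1` persists for the exponential of a
polynomial, when that exponential is bounded by `1`. -/
lemma norm_integral_mul_exp_le {w : ℝ → ℂ} (hw : Continuous w) (hw1 : ∀ s, ‖w s‖ ≤ 1) {δ : ℝ}
    (hδ : ∀ (P : Polynomial ℂ) (M : ℝ),
      (∀ s ∈ Set.Icc (-(1 / 2) : ℝ) (1 / 2), ‖P.eval (ch s)‖ ≤ M) →
      ‖∫ s in (-(1 / 2) : ℝ)..(1 / 2), w s * P.eval (ch s)‖ ≤ M * δ)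
    {Q : Polynomial ℂ} (hQ : ∀ s ∈ Set.Icc (-(1 / 2) : ℝ) (1 / 2), (Q.eval (ch s)).re ≤ 0) :
    ‖∫ s in (-(1 / 2) : ℝ)..(1 / 2), w s * Complex.exp (Q.eval (ch s))‖ ≤ δ := by
  have hlim : ∀ η : ℝ, 0 < η →
      ‖∫ s in (-(1 / 2) : ℝ)..(1 / 2), w s * Complex.exp (Q.eval (ch s))‖ ≤
        δ + η * (δ + 1) := by
    intro η hη
    obtain ⟨P, hP⟩ := exists_polynomial_exp_approx Q hη
    have h1 := hδ P (1 + η) fun s hs => by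
      have := norm_sub_norm_le (P.eval (ch s)) (Complex.exp (Q.eval (ch s)))
      rw [norm_sub_rev] at this
      have h2 : ‖Complex.exp (Q.eval (ch s))‖ ≤ 1 := by
        rw [Complex.norm_exp]; exact Real.exp_le_one_iff.mpr (hQ s hs)
      linarith [hP s hs]
    have h2 : ‖∫ s in (-(1 / 2) : ℝ)..(1 / 2),
        (w s * Complex.exp (Q.eval (ch s)) - w s * P.eval (ch s))‖ ≤ η := by
      refine (intervalIntegral.norm_integral_le_of_norm_le_const (C := η) fun s hs => ?_).trans ?_
      · rw [Set.uIoc_of_le (by norm_num)] at hs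
        rw [← mul_sub, norm_mul]
        calc _ ≤ 1 * η := by gcongr; exacts [hw1 s, hP s ⟨hs.1.le, hs.2⟩]
          _ = η := one_mul _
      · norm_num
    rw [intervalIntegral.integral_sub ((by fun_prop : Continuous _).intervalIntegrable _ _)
      ((by fun_prop : Continuous _).intervalIntegrable _ _)] at h2
    have h3 := norm_sub_norm_le (∫ s in (-(1 / 2) : ℝ)..(1 / 2),
      w s * Complex.exp (Q.eval (ch s))) (∫ s in (-(1 / 2) : ℝ)..(1 / 2), w s * P.eval (ch s))
    linarith
  have ht : Filter.Tendsto (fun η : ℝ => δ + η * (δ + 1)) (nhdsWithin 0 (Set.Ioi 0)) (nhds δ) := by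
    have : Continuous fun η : ℝ => δ + η * (δ + 1) := by fun_prop
    simpa using (this.tendsto 0).mono_left nhdsWithin_le_nhds
  exact ge_of_tendsto ht (by filter_upwards [self_mem_nhdsWithin] with η hη using hlim η hη)

/-! ### The bounded test function -/

/-- The McGehee–Pigno–Smith iteration `F₀ = g₀`, `Fₙ₊₁ = Fₙ Eₙ₊₁ + gₙ₊₁`: each new block `gₙ₊₁`
is added after damping the previous ones by the factor `Eₙ₊₁`. -/
noncomputable def testFun (g E : ℕ → ℂ) : ℕ → ℂ
  | 0 => g 0
  | n + 1 => testFun g E n * E (n + 1) + g (n + 1)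

/-- If the damping factors compensate the size of the blocks, the iteration stays bounded. -/
lemma norm_testFun_le {g E : ℕ → ℂ} {ε : ℝ} (hε : 0 < ε) (hg : ∀ j, ‖g j‖ ≤ 1)
    (hE : ∀ j, ‖E j‖ ≤ Real.exp (-(ε * ‖g j‖))) (n : ℕ) :
    ‖testFun g E n‖ ≤ 1 / (1 - Real.exp (-ε)) := by
  have hpos : 0 < 1 - Real.exp (-ε) := by
    have : Real.exp (-ε) < 1 := Real.exp_lt_one_iff.mpr (by linarith)
    linarith
  have hle : 1 ≤ 1 / (1 - Real.exp (-ε)) := by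
    rw [le_div_iff₀ hpos]; linarith [Real.exp_pos (-ε)]
  induction n with
  | zero => exact (hg 0).trans hle
  | succ n ih =>
    set x := ‖g (n + 1)‖ with hx
    have hx0 : 0 ≤ x := norm_nonneg _
    have hx1 : x ≤ 1 := hg _
    have hconv : Real.exp (-(ε * x)) ≤ (1 - x) + x * Real.exp (-ε) := by
      have := convexOn_exp.2 (Set.mem_univ 0) (Set.mem_univ (-ε)) (by linarith : 0 ≤ 1 - x) hx0
        (by ring)
      simp only [smul_eq_mul, mul_zero, zero_add, Real.exp_zero, mul_one] at this
      rwa [show x * -ε = -(ε * x) by ring] at this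
    calc ‖testFun g E n * E (n + 1) + g (n + 1)‖
        ≤ ‖testFun g E n‖ * ‖E (n + 1)‖ + x := by rw [← norm_mul]; exact norm_add_le _ _
      _ ≤ 1 / (1 - Real.exp (-ε)) * ((1 - x) + x * Real.exp (-ε)) + x := by
          gcongr; exact (hE _).trans hconv
      _ = 1 / (1 - Real.exp (-ε)) := by field_simp; ring

lemma testFun_eq_sum (g E : ℕ → ℂ) (n : ℕ) :
    testFun g E n = ∑ j ∈ range (n + 1), g j * ∏ i ∈ Ioc j n, E i := by
  induction n with
  | zero => simp [testFun]
  | succ n ih =>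
    rw [sum_range_succ, testFun, ih, sum_mul]
    congr 1
    · refine sum_congr rfl fun j hj => ?_
      have : j ≤ n := by rw [mem_range] at hj; omega
      rw [← Finset.insert_Ioc_right_eq_Ioc_add_one this, prod_insert (by simp)]
      ring
    · simp

/-- The part `w(s) ∑_{l ∈ D} u_l e^{-2πiμ_l s}` of the test function with frequencies
`-μ_l`, `l ∈ D`, before normalisation. -/
noncomputable def block (w : ℝ → ℝ) (μ : ℕ → ℝ) (u : ℕ → ℂ) (D : Finset ℕ) (s : ℝ) : ℂ :=
  w s * ∑ l ∈ D, u l * ch (-(μ l * s))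

lemma continuous_block {w : ℝ → ℝ} (hw : Continuous w) (μ : ℕ → ℝ) (u : ℕ → ℂ) (D : Finset ℕ) :
    Continuous (block w μ u D) := by
  unfold block; fun_prop

lemma norm_block_le {w : ℝ → ℝ} (hw0 : ∀ s, 0 ≤ w s) (hw1 : ∀ s, w s ≤ 1) (μ : ℕ → ℝ)
    {u : ℕ → ℂ} (hu : ∀ l, ‖u l‖ ≤ 1) (D : Finset ℕ) (s : ℝ) : ‖block w μ u D s‖ ≤ #D := by
  rw [block, norm_mul, Complex.norm_real, Real.norm_of_nonneg (hw0 s)]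
  have : ‖∑ l ∈ D, u l * ch (-(μ l * s))‖ ≤ ∑ l ∈ D, 1 :=
    norm_sum_le_of_le _ fun l _ => by rw [norm_mul, norm_ch, mul_one]; exact hu l
  calc _ ≤ 1 * ∑ l ∈ D, (1 : ℝ) := by gcongr; exact hw1 s
    _ = #D := by simp

/-- Expansion of a Fourier integral of a block. -/
lemma integral_ch_mul_block {w : ℝ → ℝ} (hw : Continuous w) (μ : ℕ → ℝ) (u : ℕ → ℂ)
    (D : Finset ℕ) (x : ℝ) {f : ℝ → ℂ} (hf : Continuous f) :
    ∫ s in (-(1 / 2) : ℝ)..(1 / 2), ch (x * s) * block w μ u D s * f s =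
      ∑ l ∈ D, u l * ∫ s in (-(1 / 2) : ℝ)..(1 / 2), w s * ch ((x - μ l) * s) * f s := by
  simp_rw [block, mul_sum, sum_mul]
  rw [intervalIntegral.integral_finsetSum]
  · refine sum_congr rfl fun l _ => ?_
    rw [← intervalIntegral.integral_const_mul]
    congr 1; ext s
    rw [sub_mul, sub_eq_add_neg, ch_add]; ring
  · intro l _
    exact (by fun_prop : Continuous _).intervalIntegrable _ _

/-- Quasi-orthogonality: if the off-diagonal terms are summably small then the `L²` norm of a block
is controlled by the number of its frequencies. -/
lemma integral_norm_sq_block_le {w : ℝ → ℝ} (hw : Continuous w) (hw0 : ∀ s, 0 ≤ w s)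
    (hw1 : ∀ s, w s ≤ 1) {μ : ℕ → ℝ} {u : ℕ → ℂ} (hu : ∀ l, ‖u l‖ ≤ 1) {D : Finset ℕ}
    {δ : ℕ → ℕ → ℝ} {η : ℝ}
    (hδ : ∀ k ∈ D, ∀ l ∈ D, k ≠ l →
      ‖∫ s in (-(1 / 2) : ℝ)..(1 / 2), (w s : ℂ) * ch ((μ k - μ l) * s)‖ ≤ δ k l)
    (hη : ∀ k ∈ D, ∑ l ∈ D.erase k, δ k l ≤ η) :
    ∫ s in (-(1 / 2) : ℝ)..(1 / 2), ‖block w μ u D s‖ ^ 2 ≤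
      #D * ((∫ s in (-(1 / 2) : ℝ)..(1 / 2), w s) + η) := by
  have hcb := continuous_block hw μ u D
  have hS0 : 0 ≤ ∫ s in (-(1 / 2) : ℝ)..(1 / 2), w s :=
    intervalIntegral.integral_nonneg (by norm_num) fun s _ => hw0 s
  -- The cross terms are collected in `∫ block * conj (∑ u_l ch)`, which majorises the left side.
  have h1 : ∫ s in (-(1 / 2) : ℝ)..(1 / 2), ‖block w μ u D s‖ ^ 2 ≤
      ∫ s in (-(1 / 2) : ℝ)..(1 / 2),
        (∑ k ∈ D, (starRingEnd ℂ) (u k) * (ch (μ k * s) * block w μ u D s * 1)).re := by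
    refine intervalIntegral.integral_mono_on (by norm_num)
      ((by fun_prop : Continuous _).intervalIntegrable _ _)
      ((Complex.continuous_re.comp (by fun_prop)).intervalIntegrable _ _) fun s _ => ?_
    have h2 : ∑ k ∈ D, (starRingEnd ℂ) (u k) * (ch (μ k * s) * block w μ u D s * 1) =
        (starRingEnd ℂ) (∑ k ∈ D, u k * ch (-(μ k * s))) * block w μ u D s := by
      rw [map_sum, sum_mul]
      refine sum_congr rfl fun k _ => ?_
      rw [map_mul, ← ch_neg, neg_neg]; ring
    rw [h2, block]
    set z := ∑ k ∈ D, u k * ch (-(μ k * s))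
    have h3 : (starRingEnd ℂ) z * (w s * z) = ((w s * ‖z‖ ^ 2 : ℝ) : ℂ) := by
      push_cast; rw [← Complex.conj_mul']; ring
    rw [h3, Complex.ofReal_re, norm_mul, Complex.norm_real, Real.norm_of_nonneg (hw0 s), mul_pow]
    gcongr
    exact pow_le_of_le_one (hw0 s) (hw1 s) two_ne_zero
  refine h1.trans ?_
  have hint : ∀ k ∈ D, IntervalIntegrable
      (fun s => (starRingEnd ℂ) (u k) * (ch (μ k * s) * block w μ u D s * 1))
      MeasureTheory.volume (-(1 / 2) : ℝ) (1 / 2) := fun k _ =>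
    (by fun_prop : Continuous _).intervalIntegrable _ _
  have h4 := Complex.reCLM.intervalIntegral_comp_comm
      (μ := MeasureTheory.volume) (a := -(1 / 2)) (b := 1 / 2)
      (f := fun s => ∑ k ∈ D, (starRingEnd ℂ) (u k) * (ch (μ k * s) * block w μ u D s * 1))
      ((by fun_prop : Continuous _).intervalIntegrable _ _)
  simp only [Complex.reCLM_apply] at h4
  rw [h4, intervalIntegral.integral_finsetSum hint]
  refine (Complex.re_le_norm _).trans ?_
  rw [← nsmul_eq_mul, ← sum_const]
  refine norm_sum_le_of_le _ fun k hk => ?_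
  rw [intervalIntegral.integral_const_mul, norm_mul, RCLike.norm_conj,
    integral_ch_mul_block hw _ _ _ _ continuous_const, ← add_sum_erase _ _ hk]
  refine (mul_le_of_le_one_left (norm_nonneg _) (hu k)).trans ((norm_add_le _ _).trans ?_)
  simp only [mul_one]
  gcongr
  · rw [norm_mul]
    refine (mul_le_of_le_one_left (norm_nonneg _) (hu k)).trans (le_of_eq ?_)
    simp only [sub_self, zero_mul, ch_zero, mul_one]
    rw [intervalIntegral.integral_ofReal, Complex.norm_real, Real.norm_of_nonneg hS0]
  · refine (norm_sum_le_of_le _ fun l hl => ?_).trans (hη k hk)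
    rw [norm_mul]
    refine (mul_le_of_le_one_left (norm_nonneg _) (hu l)).trans ?_
    exact hδ k hk l (mem_of_mem_erase hl) (ne_of_mem_erase hl).symm

/-! ### The weighted McGehee–Pigno–Smith inequality -/

/-- Damping factors: polynomials `h j` whose real parts dominate the moduli of given blocks `g j`,
with comparable `L²` norms. -/
lemma exists_damping {g : ℝ → ℂ} (hg : Continuous g) (hper : g (-(1 / 2)) = g (1 / 2)) {A : ℝ}
    (hA : ∫ s in (-(1 / 2) : ℝ)..(1 / 2), ‖g s‖ ^ 2 < A) :
    ∃ h : Polynomial ℂ, (∀ s ∈ Set.Icc (-(1 / 2) : ℝ) (1 / 2), ‖g s‖ ≤ (h.eval (ch s)).re) ∧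
      ∫ s in (-(1 / 2) : ℝ)..(1 / 2), ‖h.eval (ch s)‖ ^ 2 ≤ 2 * A := by
  have hexp : ∀ δ : ℝ, ∫ s in (-(1 / 2) : ℝ)..(1 / 2), (‖g s‖ + δ) ^ 2 =
      (∫ s in (-(1 / 2) : ℝ)..(1 / 2), ‖g s‖ ^ 2) +
        2 * δ * (∫ s in (-(1 / 2) : ℝ)..(1 / 2), ‖g s‖) + δ ^ 2 := by
    intro δ
    have : ∀ s, (‖g s‖ + δ) ^ 2 = ‖g s‖ ^ 2 + 2 * δ * ‖g s‖ + δ ^ 2 := fun s => by ring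
    simp_rw [this]
    rw [intervalIntegral.integral_add ((by fun_prop : Continuous _).intervalIntegrable _ _)
      ((by fun_prop : Continuous _).intervalIntegrable _ _),
      intervalIntegral.integral_add ((by fun_prop : Continuous _).intervalIntegrable _ _)
      ((by fun_prop : Continuous _).intervalIntegrable _ _), intervalIntegral.integral_const_mul]
    norm_num
  have hlim : Filter.Tendsto (fun δ : ℝ => ∫ s in (-(1 / 2) : ℝ)..(1 / 2), (‖g s‖ + δ) ^ 2)
      (nhdsWithin 0 (Set.Ioi 0)) (nhds (∫ s in (-(1 / 2) : ℝ)..(1 / 2), ‖g s‖ ^ 2)) := by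
    simp_rw [hexp]
    have : Continuous fun δ : ℝ => (∫ s in (-(1 / 2) : ℝ)..(1 / 2), ‖g s‖ ^ 2) +
        2 * δ * (∫ s in (-(1 / 2) : ℝ)..(1 / 2), ‖g s‖) + δ ^ 2 := by fun_prop
    simpa using (this.tendsto 0).mono_left nhdsWithin_le_nhds
  obtain ⟨δ, hδA, hδ⟩ := ((hlim.eventually (gt_mem_nhds hA)).and self_mem_nhdsWithin).exists
  obtain ⟨h, h0, hh⟩ := exists_polynomial_re_approx (g := fun s => ‖g s‖) (by fun_prop)
    (by simp only [hper]) hδ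
  refine ⟨h, fun s hs => (hh s hs).1, (integral_norm_sq_le h0).trans ?_⟩
  refine mul_le_mul_of_nonneg_left (le_trans ?_ hδA.le) (by norm_num)
  refine intervalIntegral.integral_mono_on (by norm_num)
    (((Complex.continuous_re.comp (by fun_prop)).pow 2).intervalIntegrable _ _)
    ((by fun_prop : Continuous _).intervalIntegrable _ _) fun s hs => ?_
  have := (norm_nonneg _).trans (hh s hs).1
  gcongr
  exact (hh s hs).2

/-- Damping a block `g` by `exp(-ε ∑ hᵢ)` changes its Fourier integrals by little in `L²` terms. -/
lemma norm_integral_damped_sub_le {g : ℝ → ℂ} (hg : Continuous g) {ε : ℝ} (hε : 0 < ε)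
    {h : ℕ → Polynomial ℂ} {I : Finset ℕ}
    (hre : ∀ i, ∀ s ∈ Set.Icc (-(1 / 2) : ℝ) (1 / 2), 0 ≤ ((h i).eval (ch s)).re)
    {A : ℝ} (hA : 0 < A) (hgA : ∫ s in (-(1 / 2) : ℝ)..(1 / 2), ‖g s‖ ^ 2 ≤ A ^ 2)
    {B : ℕ → ℝ} (hB : ∀ i, 0 < B i)
    (hhB : ∀ i, ∫ s in (-(1 / 2) : ℝ)..(1 / 2), ‖(h i).eval (ch s)‖ ^ 2 ≤ B i ^ 2) (x : ℝ) :
    ‖(∫ s in (-(1 / 2) : ℝ)..(1 / 2), ch (x * s) * g s *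
        Complex.exp ((Polynomial.C (-ε : ℂ) * ∑ i ∈ I, h i).eval (ch s))) -
      ∫ s in (-(1 / 2) : ℝ)..(1 / 2), ch (x * s) * g s * 1‖ ≤ ε * ∑ i ∈ I, A * B i := by
  have hc : ∀ P : Polynomial ℂ, Continuous fun s : ℝ => P.eval (ch s) := fun P => by fun_prop
  rw [← intervalIntegral.integral_sub ((by fun_prop : Continuous _).intervalIntegrable _ _)
    ((by fun_prop : Continuous _).intervalIntegrable _ _)]
  have h1 : ∀ s ∈ Set.Icc (-(1 / 2) : ℝ) (1 / 2),
      ‖ch (x * s) * g s * Complex.exp ((Polynomial.C (-ε : ℂ) * ∑ i ∈ I, h i).eval (ch s)) -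
        ch (x * s) * g s * 1‖ ≤ ε * ∑ i ∈ I, ‖g s‖ * ‖(h i).eval (ch s)‖ := by
    intro s hs
    rw [← mul_sub, norm_mul, norm_mul, norm_ch, one_mul]
    have hev : (Polynomial.C (-ε : ℂ) * ∑ i ∈ I, h i).eval (ch s) =
        ((-ε : ℝ) : ℂ) * ∑ i ∈ I, (h i).eval (ch s) := by
      simp [Polynomial.eval_finsetSum]
    have hz : ((Polynomial.C (-ε : ℂ) * ∑ i ∈ I, h i).eval (ch s)).re ≤ 0 := by
      rw [hev, Complex.re_ofReal_mul, Complex.re_sum]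
      have := sum_nonneg fun i (_ : i ∈ I) => hre i s hs
      nlinarith
    calc _ ≤ ‖g s‖ * ‖(Polynomial.C (-ε : ℂ) * ∑ i ∈ I, h i).eval (ch s)‖ := by
          gcongr; exact norm_exp_sub_one_le_of_re_nonpos hz
      _ ≤ ‖g s‖ * (ε * ∑ i ∈ I, ‖(h i).eval (ch s)‖) := by
          rw [hev, norm_mul, Complex.norm_real, norm_neg, Real.norm_of_nonneg hε.le]
          gcongr; exact norm_sum_le _ _
      _ = _ := by rw [← mul_sum]; ring
  have h2 := intervalIntegral.norm_integral_le_integral_norm (μ := MeasureTheory.volume)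
    (f := fun s => ch (x * s) * g s *
        Complex.exp ((Polynomial.C (-ε : ℂ) * ∑ i ∈ I, h i).eval (ch s)) - ch (x * s) * g s * 1)
    (a := (-(1 / 2) : ℝ)) (b := 1 / 2) (by norm_num)
  refine h2.trans ((intervalIntegral.integral_mono_on (by norm_num)
    ((by fun_prop : Continuous _).intervalIntegrable _ _)
    ((by fun_prop : Continuous _).intervalIntegrable _ _) h1).trans ?_)
  rw [intervalIntegral.integral_const_mul, intervalIntegral.integral_finsetSum
    fun i _ => (by fun_prop : Continuous _).intervalIntegrable _ _]
  gcongr with i hi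
  exact integral_mul_le_of_sq_le (by fun_prop) (by fun_prop) hA (hB i) hgA (hhB i)

/-- The weighted McGehee–Pigno–Smith inequality. The indices `1, …, N` are distributed into
consecutive blocks by `blk`, the `j`-th block having at most `t^{-2j}` elements; `δ k l` bounds the
interaction of the frequencies `μ k` and `μ l`, both directly (`hδ`) and, when `l < k`, against
analytic polynomials (`hδan`). Only the blocks `0, …, J` are used in the test function. -/
theorem weighted_lower_bound {N J : ℕ} {blk : ℕ → ℕ} {t ε K η : ℝ} {μ : ℕ → ℝ} {w : ℝ → ℝ}
    {δ : ℕ → ℕ → ℝ} (a : ℕ → ℂ) (ht : 0 < t) (hε : 0 < ε) (hη0 : 0 ≤ η)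
    (hcard : ∀ j, #{k ∈ Icc 1 N | blk k = j} * t ^ (2 * j) ≤ 1)
    (hmono : ∀ k l, blk l < blk k → l < k)
    (hw : Continuous w) (hw0 : ∀ s, 0 ≤ w s) (hw1 : ∀ s, w s ≤ 1)
    (hper : ∀ k ∈ Icc 1 N,
      (w (-(1 / 2)) : ℂ) * ch (-(μ k * -(1 / 2))) = w (1 / 2) * ch (-(μ k * (1 / 2))))
    (hδ : ∀ k ∈ Icc 1 N, ∀ l ∈ Icc 1 N, k ≠ l →
      ‖∫ s in (-(1 / 2) : ℝ)..(1 / 2), (w s : ℂ) * ch ((μ k - μ l) * s)‖ ≤ δ k l)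
    (hδan : ∀ k ∈ Icc 1 N, ∀ l ∈ Icc 1 N, l < k → ∀ (P : Polynomial ℂ) (M : ℝ),
      (∀ s ∈ Set.Icc (-(1 / 2) : ℝ) (1 / 2), ‖P.eval (ch s)‖ ≤ M) →
      ‖∫ s in (-(1 / 2) : ℝ)..(1 / 2), w s * ch ((μ k - μ l) * s) * P.eval (ch s)‖ ≤ M * δ k l)
    (hη : ∀ k ∈ Icc 1 N, ∑ l ∈ (Icc 1 N).erase k, t ^ (2 * blk l) * δ k l ≤ η * t ^ (2 * blk k))
    (hK : (∫ s in (-(1 / 2) : ℝ)..(1 / 2), w s) + η < K) :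
    ∑ k ∈ Icc 1 N, ‖a k‖ *
        ((if blk k ≤ J then (∫ s in (-(1 / 2) : ℝ)..(1 / 2), w s) * t ^ (2 * blk k) else 0)
          - η * t ^ (2 * blk k)
          - ε * √2 * K * ∑ j ∈ Icc (blk k) J, ∑ i ∈ Ioc j J, t ^ j * t ^ i) ≤
      1 / (1 - Real.exp (-ε)) *
        ∫ s in (-(1 / 2) : ℝ)..(1 / 2), ‖∑ k ∈ Icc 1 N, a k * ch (μ k * s)‖ := by
  set S0 := ∫ s in (-(1 / 2) : ℝ)..(1 / 2), w s with hS0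
  have hS0' : 0 ≤ S0 := intervalIntegral.integral_nonneg (by norm_num) fun s _ => hw0 s
  have hKpos : 0 < K := by linarith
  have hδ0 : ∀ k ∈ Icc 1 N, ∀ l ∈ Icc 1 N, k ≠ l → 0 ≤ δ k l := fun k hk l hl hkl =>
    (norm_nonneg _).trans (hδ k hk l hl hkl)
  -- The phases of the coefficients.
  obtain ⟨u, hu1, hua⟩ : ∃ u : ℕ → ℂ, (∀ k, ‖u k‖ ≤ 1) ∧ ∀ k, a k * u k = ‖a k‖ := by
    have : ∀ k, ∃ z : ℂ, ‖z‖ ≤ 1 ∧ a k * z = ‖a k‖ := by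
      intro k
      rcases eq_or_ne (a k) 0 with h | h
      · exact ⟨0, by simp, by simp [h]⟩
      · have hn : (‖a k‖ : ℂ) ≠ 0 := by exact_mod_cast norm_ne_zero_iff.mpr h
        refine ⟨(starRingEnd ℂ) (a k) / ‖a k‖, ?_, ?_⟩
        · rw [norm_div, RCLike.norm_conj, Complex.norm_real, norm_norm,
            div_self (norm_ne_zero_iff.mpr h)]
        · rw [mul_div_assoc', Complex.mul_conj', pow_two, mul_div_assoc, div_self hn, mul_one]
    choose u hu using this
    exact ⟨u, fun k => (hu k).1, fun k => (hu k).2⟩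
  let D : ℕ → Finset ℕ := fun j => {k ∈ Icc 1 N | blk k = j}
  have hDsub : ∀ j, ∀ l ∈ D j, l ∈ Icc 1 N ∧ blk l = j := fun j l hl => by
    simpa only [D, mem_filter] using hl
  let g : ℕ → ℝ → ℂ := fun j s => ((t ^ (2 * j) : ℝ) : ℂ) * block w μ u (D j) s
  have hgc : ∀ j, Continuous (g j) := fun j => continuous_const.mul (continuous_block hw μ u (D j))
  have hg1 : ∀ j s, ‖g j s‖ ≤ 1 := by
    intro j s
    simp only [g]
    rw [norm_mul, Complex.norm_real, Real.norm_of_nonneg (by positivity)]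
    calc _ ≤ t ^ (2 * j) * #(D j) := by gcongr; exact norm_block_le hw0 hw1 μ hu1 _ _
      _ ≤ 1 := by rw [mul_comm]; exact hcard j
  have hg2 : ∀ j, ∫ s in (-(1 / 2) : ℝ)..(1 / 2), ‖g j s‖ ^ 2 ≤ t ^ (2 * j) * (S0 + η) := by
    intro j
    have h1 : ∀ s, ‖g j s‖ ^ 2 = (t ^ (2 * j)) ^ 2 * ‖block w μ u (D j) s‖ ^ 2 := by
      intro s
      simp only [g]
      rw [norm_mul, Complex.norm_real, Real.norm_of_nonneg (by positivity), mul_pow]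
    simp_rw [h1]
    rw [intervalIntegral.integral_const_mul]
    have h2 := integral_norm_sq_block_le hw hw0 hw1 hu1 (D := D j) (δ := δ) (η := η) (μ := μ)
      (fun k hk l hl hkl => hδ k (hDsub j k hk).1 l (hDsub j l hl).1 hkl) (fun k hk => by
        have h3 : ∑ l ∈ (D j).erase k, t ^ (2 * j) * δ k l ≤ η * t ^ (2 * j) := by
          rw [← (hDsub j k hk).2]
          refine le_trans ?_ (hη k (hDsub j k hk).1)
          calc _ = ∑ l ∈ (D (blk k)).erase k, t ^ (2 * blk l) * δ k l := by
                refine sum_congr rfl fun l hl => ?_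
                rw [(hDsub _ l (mem_of_mem_erase hl)).2]
            _ ≤ _ := by
                refine sum_le_sum_of_subset_of_nonneg
                  (erase_subset_erase _ (filter_subset _ _)) fun l hl _ => ?_
                have := hδ0 k (hDsub j k hk).1 l (mem_of_mem_erase hl) (ne_of_mem_erase hl).symm
                positivity
        rw [← mul_sum, mul_comm η] at h3
        exact le_of_mul_le_mul_left h3 (by positivity))
    calc _ ≤ (t ^ (2 * j)) ^ 2 * (#(D j) * (S0 + η)) := by gcongr
      _ = (#(D j) * t ^ (2 * j)) * (t ^ (2 * j) * (S0 + η)) := by ring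
      _ ≤ 1 * (t ^ (2 * j) * (S0 + η)) := by gcongr; exact hcard j
      _ = _ := one_mul _
  have hgper : ∀ j, g j (-(1 / 2)) = g j (1 / 2) := by
    intro j
    simp only [g, block, mul_sum]
    refine sum_congr rfl fun l hl => ?_
    have := hper l (hDsub j l hl).1
    linear_combination (((t ^ (2 * j) : ℝ) : ℂ) * u l) * this
  have hdamp : ∀ j, ∃ h : Polynomial ℂ,
      (∀ s ∈ Set.Icc (-(1 / 2) : ℝ) (1 / 2), ‖g j s‖ ≤ (h.eval (ch s)).re) ∧
      ∫ s in (-(1 / 2) : ℝ)..(1 / 2), ‖h.eval (ch s)‖ ^ 2 ≤ 2 * (t ^ (2 * j) * K) := fun j =>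
    exists_damping (hgc j) (hgper j) ((hg2 j).trans_lt (by gcongr))
  choose h hh hh2 using hdamp
  have hre : ∀ i, ∀ s ∈ Set.Icc (-(1 / 2) : ℝ) (1 / 2), 0 ≤ ((h i).eval (ch s)).re :=
    fun i s hs => (norm_nonneg _).trans (hh i s hs)
  let Q : ℕ → Polynomial ℂ := fun j => Polynomial.C (-ε : ℂ) * ∑ i ∈ Ioc j J, h i
  have hQev : ∀ j s, (Q j).eval (ch s) = ∑ i ∈ Ioc j J, ((-ε : ℝ) : ℂ) * (h i).eval (ch s) := by
    intro j s
    simp [Q, Polynomial.eval_finsetSum, mul_sum]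
  have hQre : ∀ j, ∀ s ∈ Set.Icc (-(1 / 2) : ℝ) (1 / 2), ((Q j).eval (ch s)).re ≤ 0 := by
    intro j s hs
    rw [hQev, Complex.re_sum]
    refine sum_nonpos fun i _ => ?_
    rw [Complex.re_ofReal_mul]
    nlinarith [hre i s hs]
  have hQc : ∀ j, Continuous fun s : ℝ => (Q j).eval (ch s) := fun j => by fun_prop
  let F : ℝ → ℂ := fun s => ∑ j ∈ range (J + 1), g j s * Complex.exp ((Q j).eval (ch s))
  have hFc : Continuous F := by
    refine continuous_finsetSum _ fun j _ => ?_
    have := hgc j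
    have := hQc j
    fun_prop
  have hF : ∀ s ∈ Set.Icc (-(1 / 2) : ℝ) (1 / 2), ‖F s‖ ≤ 1 / (1 - Real.exp (-ε)) := by
    intro s hs
    have h1 := norm_testFun_le (g := fun j => g j s)
      (E := fun i => Complex.exp (((-ε : ℝ) : ℂ) * (h i).eval (ch s))) hε (fun j => hg1 j s)
      (fun j => by
        rw [Complex.norm_exp, Complex.re_ofReal_mul, neg_mul]
        have := hh j s hs
        gcongr) J
    rw [testFun_eq_sum] at h1
    convert h1 using 2
    refine sum_congr rfl fun j _ => ?_
    rw [hQev, Complex.exp_sum]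
  let G : ℕ → ℕ → ℂ := fun k j =>
    ∫ s in (-(1 / 2) : ℝ)..(1 / 2), ch (μ k * s) * g j s * Complex.exp ((Q j).eval (ch s))
  -- Upper bound for the pairing of the polynomial with the test function.
  have hpair : ‖∑ k ∈ Icc 1 N, a k * ∑ j ∈ range (J + 1), G k j‖ ≤ 1 / (1 - Real.exp (-ε)) *
        ∫ s in (-(1 / 2) : ℝ)..(1 / 2), ‖∑ k ∈ Icc 1 N, a k * ch (μ k * s)‖ := by
    have h1 : ∑ k ∈ Icc 1 N, a k * ∑ j ∈ range (J + 1), G k j =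
        ∫ s in (-(1 / 2) : ℝ)..(1 / 2), (∑ k ∈ Icc 1 N, a k * ch (μ k * s)) * F s := by
      have h2 : ∀ s : ℝ, (∑ k ∈ Icc 1 N, a k * ch (μ k * s)) * F s =
          ∑ k ∈ Icc 1 N, a k * ∑ j ∈ range (J + 1),
            ch (μ k * s) * g j s * Complex.exp ((Q j).eval (ch s)) := by
        intro s
        rw [sum_mul]
        refine sum_congr rfl fun k _ => ?_
        simp only [F, mul_sum]
        exact sum_congr rfl fun j _ => by ring
      simp_rw [h2]
      rw [intervalIntegral.integral_finsetSum]
      · refine sum_congr rfl fun k _ => ?_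
        rw [intervalIntegral.integral_const_mul, intervalIntegral.integral_finsetSum]
        intro j _
        have := hgc j
        exact (by fun_prop : Continuous _).intervalIntegrable _ _
      · intro k _
        exact (by fun_prop : Continuous _).intervalIntegrable _ _
    rw [h1, ← intervalIntegral.integral_const_mul]
    refine (intervalIntegral.norm_integral_le_integral_norm (by norm_num)).trans ?_
    refine intervalIntegral.integral_mono_on (by norm_num)
      ((by fun_prop : Continuous _).intervalIntegrable _ _)
      ((by fun_prop : Continuous _).intervalIntegrable _ _) fun s hs => ?_
    rw [norm_mul, mul_comm]
    gcongr
    exact hF s hs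
  refine le_trans ?_ ((Complex.re_le_norm _).trans hpair)
  rw [Complex.re_sum]
  refine sum_le_sum fun k hk => ?_
  set m := blk k with hm
  -- The part of the interaction bound due to the block `j`.
  let R : ℕ → ℝ := fun j => ∑ l ∈ (D j).erase k, t ^ (2 * j) * δ k l
  have hR : ∑ j ∈ range (J + 1), R j ≤ η * t ^ (2 * m) := by
    refine le_trans ?_ (hη k hk)
    have h1 : ∑ j ∈ range (J + 1), R j =
        ∑ j ∈ range (J + 1), ∑ l ∈ {l ∈ (Icc 1 N).erase k | blk l = j},
          t ^ (2 * blk l) * δ k l := by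
      refine sum_congr rfl fun j _ => ?_
      simp only [R, D]
      rw [← filter_erase]
      exact sum_congr rfl fun l hl => by rw [(mem_filter.mp hl).2]
    rw [h1]
    have hnn : ∀ l ∈ (Icc 1 N).erase k, 0 ≤ t ^ (2 * blk l) * δ k l := fun l hl =>
      mul_nonneg (by positivity)
        (hδ0 k hk l (mem_of_mem_erase hl) (ne_of_mem_erase hl).symm)
    exact sum_fiberwise_le_sum_of_sum_fiber_nonneg fun j _ =>
      sum_nonneg fun l hl => hnn l (filter_subset _ _ hl)
  -- Fourier integrals of the damped blocks of lower index are negligible.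
  have hlow : ∀ j, j < m → ‖G k j‖ ≤ R j := by
    intro j hj
    have hkD : k ∉ D j := fun hk' => by have := (hDsub j k hk').2; omega
    simp only [R, G, g]
    rw [erase_eq_of_notMem hkD, ← mul_sum]
    have h1 : ∀ s : ℝ, ch (μ k * s) * (((t ^ (2 * j) : ℝ) : ℂ) * block w μ u (D j) s) *
        Complex.exp ((Q j).eval (ch s)) = ((t ^ (2 * j) : ℝ) : ℂ) *
        (ch (μ k * s) * block w μ u (D j) s * Complex.exp ((Q j).eval (ch s))) := fun s => by ring
    simp_rw [h1]
    rw [intervalIntegral.integral_const_mul, norm_mul, Complex.norm_real,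
      Real.norm_of_nonneg (by positivity), integral_ch_mul_block hw _ _ _ _ (by fun_prop)]
    gcongr
    refine norm_sum_le_of_le _ fun l hl => ?_
    rw [norm_mul]
    refine (mul_le_of_le_one_left (norm_nonneg _) (hu1 l)).trans ?_
    refine norm_integral_mul_exp_le (w := fun s => w s * ch ((μ k - μ l) * s)) (by fun_prop)
      (fun s => ?_) ?_ (hQre j)
    · rw [norm_mul, norm_ch, mul_one, Complex.norm_real, Real.norm_of_nonneg (hw0 s)]
      exact hw1 s
    · exact hδan k hk l (hDsub j l hl).1 (hmono k l (by rw [(hDsub j l hl).2]; exact hj))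
  -- Undamped Fourier integrals.
  have hund : ∀ j, ‖(∫ s in (-(1 / 2) : ℝ)..(1 / 2), ch (μ k * s) * g j s * 1) -
      (if j = m then ((S0 * t ^ (2 * m) : ℝ) : ℂ) * u k else 0)‖ ≤ R j := by
    intro j
    have h1 : ∀ s : ℝ, ch (μ k * s) * g j s * 1 =
        ((t ^ (2 * j) : ℝ) : ℂ) * (ch (μ k * s) * block w μ u (D j) s * 1) := by
      intro s; simp only [g]; ring
    simp_rw [h1]
    rw [intervalIntegral.integral_const_mul, integral_ch_mul_block hw _ _ _ _ continuous_const]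
    simp only [mul_one, R]
    have h2 : ‖∑ l ∈ (D j).erase k, u l *
        ∫ s in (-(1 / 2) : ℝ)..(1 / 2), (w s : ℂ) * ch ((μ k - μ l) * s)‖ ≤
          ∑ l ∈ (D j).erase k, δ k l := by
      refine norm_sum_le_of_le _ fun l hl => ?_
      rw [norm_mul]
      refine (mul_le_of_le_one_left (norm_nonneg _) (hu1 l)).trans ?_
      exact hδ k hk l (hDsub j l (mem_of_mem_erase hl)).1 (ne_of_mem_erase hl).symm
    rw [← mul_sum]
    split_ifs with hj
    · have hkD : k ∈ D j := by simp only [D, mem_filter]; exact ⟨hk, by rw [hj]⟩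
      rw [← add_sum_erase _ _ hkD]
      simp only [sub_self, zero_mul, ch_zero, mul_one]
      rw [intervalIntegral.integral_ofReal, ← hS0, mul_add, hj]
      have h3 : ∀ z : ℂ, ((t ^ (2 * m) : ℝ) : ℂ) * (u k * S0) + z -
          ((S0 * t ^ (2 * m) : ℝ) : ℂ) * u k = z := by
        intro z; push_cast; ring
      rw [h3, norm_mul, Complex.norm_real, Real.norm_of_nonneg (by positivity)]
      rw [hj] at h2
      gcongr
    · have hkD : k ∉ D j := fun hk' => hj (hDsub j k hk').2.symm
      rw [sub_zero, norm_mul, Complex.norm_real, Real.norm_of_nonneg (by positivity)]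
      rw [erase_eq_of_notMem hkD] at h2 ⊢
      gcongr
  have hhigh : ∀ j, ‖G k j - (∫ s in (-(1 / 2) : ℝ)..(1 / 2), ch (μ k * s) * g j s * 1)‖ ≤
      ε * √2 * K * ∑ i ∈ Ioc j J, t ^ j * t ^ i := by
    intro j
    have h1 := norm_integral_damped_sub_le (hgc j) hε (I := Ioc j J) hre
      (A := t ^ j * √K) (by positivity) (by
        refine (hg2 j).trans ?_
        rw [mul_pow, Real.sq_sqrt hKpos.le, ← pow_mul, mul_comm j 2]
        gcongr)
      (B := fun i => √2 * (t ^ i * √K)) (fun i => by positivity) (fun i => by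
        refine (hh2 i).trans (le_of_eq ?_)
        rw [mul_pow, mul_pow, Real.sq_sqrt hKpos.le, Real.sq_sqrt (by norm_num), ← pow_mul,
          mul_comm i 2]) (μ k)
    refine h1.trans (le_of_eq ?_)
    rw [mul_sum, mul_sum]
    refine sum_congr rfl fun i _ => ?_
    have := Real.mul_self_sqrt hKpos.le
    linear_combination (ε * √2 * t ^ j * t ^ i) * this
  -- Assembling the three estimates.
  have hfin : ‖∑ j ∈ range (J + 1), G k j -
      (if m ≤ J then ((S0 * t ^ (2 * m) : ℝ) : ℂ) * u k else 0)‖ ≤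
      η * t ^ (2 * m) + ε * √2 * K * ∑ j ∈ Icc m J, ∑ i ∈ Ioc j J, t ^ j * t ^ i := by
    have h1 : (if m ≤ J then ((S0 * t ^ (2 * m) : ℝ) : ℂ) * u k else 0) =
        ∑ j ∈ range (J + 1), if j = m then ((S0 * t ^ (2 * m) : ℝ) : ℂ) * u k else 0 := by
      rw [sum_ite_eq']
      simp only [mem_range, Nat.lt_succ_iff]
    have h2 : ∑ j ∈ Icc m J, ∑ i ∈ Ioc j J, t ^ j * t ^ i =
        ∑ j ∈ range (J + 1), if m ≤ j then ∑ i ∈ Ioc j J, t ^ j * t ^ i else 0 := by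
      rw [← sum_filter]
      refine sum_congr ?_ fun _ _ => rfl
      ext j; simp only [mem_Icc, mem_filter, mem_range]; omega
    rw [h1, ← sum_sub_distrib, h2, mul_sum]
    have h3 : ∀ j ∈ range (J + 1), ‖G k j -
        (if j = m then ((S0 * t ^ (2 * m) : ℝ) : ℂ) * u k else 0)‖ ≤ R j +
        ε * √2 * K * if m ≤ j then ∑ i ∈ Ioc j J, t ^ j * t ^ i else 0 := by
      intro j _
      by_cases hj : m ≤ j
      · rw [if_pos hj]
        have := norm_add_le (G k j - (∫ s in (-(1 / 2) : ℝ)..(1 / 2), ch (μ k * s) * g j s * 1))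
          ((∫ s in (-(1 / 2) : ℝ)..(1 / 2), ch (μ k * s) * g j s * 1) -
            (if j = m then ((S0 * t ^ (2 * m) : ℝ) : ℂ) * u k else 0))
        rw [sub_add_sub_cancel] at this
        linarith [hund j, hhigh j]
      · rw [if_neg hj, if_neg (by omega), sub_zero, mul_zero, add_zero]
        exact hlow j (by omega)
    refine (norm_sum_le_of_le _ h3).trans ?_
    rw [sum_add_distrib, ← mul_sum]
    gcongr
  set Z := ∑ j ∈ range (J + 1), G k j
  set E := ∑ j ∈ Icc m J, ∑ i ∈ Ioc j J, t ^ j * t ^ i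
  have h1 : a k * Z = a k * (if m ≤ J then ((S0 * t ^ (2 * m) : ℝ) : ℂ) * u k else 0) +
      a k * (Z - (if m ≤ J then ((S0 * t ^ (2 * m) : ℝ) : ℂ) * u k else 0)) := by ring
  have h2 : a k * (if m ≤ J then ((S0 * t ^ (2 * m) : ℝ) : ℂ) * u k else 0) =
      ((‖a k‖ * (if m ≤ J then S0 * t ^ (2 * m) else 0) : ℝ) : ℂ) := by
    split_ifs
    · rw [mul_left_comm, hua]; push_cast; ring
    · simp
  have h3 := (Complex.abs_re_le_norm
    (a k * (Z - (if m ≤ J then ((S0 * t ^ (2 * m) : ℝ) : ℂ) * u k else 0))))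
  rw [norm_mul] at h3
  have h4 := mul_le_mul_of_nonneg_left hfin (norm_nonneg (a k))
  rw [h1, h2, Complex.add_re, Complex.ofReal_re]
  have h5 := neg_abs_le
    (a k * (Z - (if m ≤ J then ((S0 * t ^ (2 * m) : ℝ) : ℂ) * u k else 0))).re
  linarith

/-! ### Geometric blocks -/

/-- The index of the block containing `k ≥ 1`, when `1, 2, 3, …` are split into consecutive blocks
of sizes `1, p + 1, (p + 1)², …`. -/
def blockIndex (p k : ℕ) : ℕ := Nat.log (p + 1) (p * k)

lemma mul_geomSum_add_one (p j : ℕ) : p * ∑ i ∈ range j, (p + 1) ^ i + 1 = (p + 1) ^ j := by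
  induction j with
  | zero => simp
  | succ j ih => rw [sum_range_succ, mul_add, add_right_comm, ih]; ring

lemma blockIndex_eq_iff {p k j : ℕ} (hp : 1 ≤ p) (hk : 1 ≤ k) : blockIndex p k = j ↔
    ∑ i ∈ range j, (p + 1) ^ i < k ∧ k ≤ ∑ i ∈ range (j + 1), (p + 1) ^ i := by
  have hpk : p * k ≠ 0 := by positivity
  rw [blockIndex, Nat.log_eq_iff (Or.inr ⟨by omega, hpk⟩), ← mul_geomSum_add_one p j,
    ← mul_geomSum_add_one p (j + 1), Nat.succ_le_iff, Nat.lt_succ_iff,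
    Nat.mul_lt_mul_left hp, Nat.mul_le_mul_left_iff hp]

lemma blockIndex_mono (p : ℕ) : Monotone (blockIndex p) := fun _ _ h =>
  Nat.log_mono_right (Nat.mul_le_mul_left p h)

lemma lt_of_blockIndex_lt {p k l : ℕ} (h : blockIndex p l < blockIndex p k) : l < k :=
  (blockIndex_mono p).reflect_lt h

lemma card_block_le {p : ℕ} (hp : 1 ≤ p) (N j : ℕ) :
    #{k ∈ Icc 1 N | blockIndex p k = j} ≤ (p + 1) ^ j := by
  calc _ ≤ #(Ioc (∑ i ∈ range j, (p + 1) ^ i) (∑ i ∈ range (j + 1), (p + 1) ^ i)) := by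
        refine card_le_card fun k hk => ?_
        rw [mem_filter, mem_Icc] at hk
        exact mem_Ioc.mpr ((blockIndex_eq_iff hp hk.1.1).mp hk.2)
    _ = (p + 1) ^ j := by rw [Nat.card_Ioc, sum_range_succ]; omega

/-- Blocks strictly before that of `N + 1` are complete. -/
lemma card_block_eq {p : ℕ} (hp : 1 ≤ p) {N j : ℕ} (hj : j < blockIndex p (N + 1)) :
    #{k ∈ Icc 1 N | blockIndex p k = j} = (p + 1) ^ j := by
  have hN := ((blockIndex_eq_iff hp (by omega : 1 ≤ N + 1)).mp rfl).1
  have hle : ∑ i ∈ range (j + 1), (p + 1) ^ i ≤ N := by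
    refine le_trans (sum_le_sum_of_subset (range_mono (by omega : j + 1 ≤ _))) (Nat.lt_succ_iff.mp hN)
  calc _ = #(Ioc (∑ i ∈ range j, (p + 1) ^ i) (∑ i ∈ range (j + 1), (p + 1) ^ i)) := by
        congr 1; ext k
        rw [mem_filter, mem_Icc, mem_Ioc]
        constructor
        · rintro ⟨h1, h2⟩; exact (blockIndex_eq_iff hp h1.1).mp h2
        · intro h
          exact ⟨⟨by omega, h.2.trans hle⟩, (blockIndex_eq_iff hp (by omega)).mpr h⟩
    _ = (p + 1) ^ j := by rw [Nat.card_Ioc, sum_range_succ]; omega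

lemma pow_two_mul_eq {p : ℕ} {t : ℝ} (ht : t ^ 2 * (p + 1) = 1) (j : ℕ) :
    t ^ (2 * j) * ((p + 1 : ℕ) : ℝ) ^ j = 1 := by
  rw [pow_mul, ← mul_pow]; push_cast; rw [ht, one_pow]

lemma card_block_mul_pow_le {p : ℕ} (hp : 1 ≤ p) {t : ℝ} (ht : t ^ 2 * (p + 1) = 1) (N j : ℕ) :
    #{k ∈ Icc 1 N | blockIndex p k = j} * t ^ (2 * j) ≤ 1 := by
  have h : (#{k ∈ Icc 1 N | blockIndex p k = j} : ℝ) ≤ ((p + 1 : ℕ) : ℝ) ^ j := by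
    exact_mod_cast card_block_le hp N j
  rw [← pow_two_mul_eq ht j, mul_comm]
  exact mul_le_mul_of_nonneg_left h (by rw [pow_mul]; positivity)

lemma one_le_mul_pow_blockIndex {p : ℕ} (hp : 1 ≤ p) {t : ℝ} (ht : t ^ 2 * (p + 1) = 1) {k : ℕ}
    (hk : 1 ≤ k) : 1 ≤ p * k * t ^ (2 * blockIndex p k) := by
  have h1 : (p + 1) ^ blockIndex p k ≤ p * k := Nat.pow_log_le_self _ (by positivity)
  have h2 : (((p + 1 : ℕ) : ℝ)) ^ blockIndex p k ≤ p * k := by exact_mod_cast h1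
  rw [← pow_two_mul_eq ht (blockIndex p k), mul_comm]
  have : 0 ≤ t ^ (2 * blockIndex p k) := by rw [pow_mul]; positivity
  gcongr

/-- Geometric tail of the interaction between the damping factors. -/
lemma sum_tail_le {t : ℝ} (ht0 : 0 < t) (ht1 : t < 1) (m J : ℕ) :
    ∑ j ∈ Icc m J, ∑ i ∈ Ioc j J, t ^ j * t ^ i ≤ t ^ (2 * m) * (t / ((1 - t) * (1 - t ^ 2))) := by
  have h1 : 0 < 1 - t := by linarith
  have h2 : 0 < 1 - t ^ 2 := by nlinarith
  calc _ ≤ ∑ j ∈ Icc m J, (t / (1 - t)) * (t ^ 2) ^ j := by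
        refine sum_le_sum fun j _ => ?_
        rw [← mul_sum]
        have : Ioc j J = Ico (j + 1) (J + 1) := by ext i; simp only [mem_Ioc, mem_Ico]; omega
        rw [this]
        calc _ ≤ t ^ j * (t ^ (j + 1) / (1 - t)) := by
              gcongr; exact geom_sum_Ico_le_of_lt_one ht0.le ht1
          _ = _ := by ring
    _ ≤ (t / (1 - t)) * ((t ^ 2) ^ m / (1 - t ^ 2)) := by
        rw [← mul_sum]
        have : Icc m J = Ico m (J + 1) := by ext i; simp only [mem_Icc, mem_Ico]; omega
        rw [this]
        gcongr
        exact geom_sum_Ico_le_of_lt_one (by positivity) (by nlinarith)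
    _ = _ := by rw [← pow_mul]; field_simp

lemma exp_neg_quarter_le : Real.exp (-(1 / 4)) ≤ 0.779 := by
  rw [Real.exp_neg]
  have := Real.sum_le_exp_of_nonneg (show (0 : ℝ) ≤ 1 / 4 by norm_num) 4
  simp only [sum_range_succ, range_zero, sum_empty] at this
  norm_num [Nat.factorial] at this
  rw [inv_le_comm₀ (Real.exp_pos _) (by norm_num)]
  refine le_trans ?_ this
  norm_num

/-- The weighted inequality with blocks of sizes `4ʲ`, all of them in use, and `ε = 1/4`, cleared
of its block structure. -/
lemma sum_div_succ_le {N : ℕ} {a : ℕ → ℂ} {S η K X : ℝ} (hK : 0 ≤ K) (hX : 0 ≤ X)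
    (hpos : 0 ≤ S - η - 0.4715 * K)
    (h : ∑ k ∈ Icc 1 N, ‖a k‖ *
        ((if blockIndex 3 k ≤ blockIndex 3 N then S * (1 / 2) ^ (2 * blockIndex 3 k) else 0)
          - η * (1 / 2) ^ (2 * blockIndex 3 k)
          - 1 / 4 * √2 * K * ∑ j ∈ Icc (blockIndex 3 k) (blockIndex 3 N),
            ∑ i ∈ Ioc j (blockIndex 3 N), (1 / 2 : ℝ) ^ j * (1 / 2) ^ i) ≤
      1 / (1 - Real.exp (-(1 / 4))) * X) :
    0.221 / 3 * (S - η - 0.4715 * K) * ∑ k ∈ Icc 1 N, ‖a k‖ / ((k : ℝ) + 1) ≤ X := by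
  set c := S - η - 0.4715 * K with hc
  have he : 0.221 ≤ 1 - Real.exp (-(1 / 4)) := by linarith [exp_neg_quarter_le]
  have h2 : √2 ≤ 1.4143 := by rw [Real.sqrt_le_left (by norm_num)]; norm_num
  have h1 : ∑ k ∈ Icc 1 N, ‖a k‖ * (c / 3 / ((k : ℝ) + 1)) ≤
      1 / (1 - Real.exp (-(1 / 4))) * X := by
    refine le_trans (sum_le_sum fun k hk => ?_) h
    rw [mem_Icc] at hk
    rw [if_pos (blockIndex_mono 3 hk.2)]
    gcongr
    set T : ℝ := (1 / 2) ^ (2 * blockIndex 3 k) with hT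
    have h3 := sum_tail_le (t := 1 / 2) (by norm_num) (by norm_num) (blockIndex 3 k) (blockIndex 3 N)
    have h4 : 1 ≤ (3 : ℕ) * k * T :=
      one_le_mul_pow_blockIndex (p := 3) (t := 1 / 2) (by norm_num) (by norm_num) hk.1
    have hT0 : 0 < T := by positivity
    set E := ∑ j ∈ Icc (blockIndex 3 k) (blockIndex 3 N),
      ∑ i ∈ Ioc j (blockIndex 3 N), (1 / 2 : ℝ) ^ j * (1 / 2) ^ i with hE
    have hE0 : 0 ≤ E := sum_nonneg fun j _ => sum_nonneg fun i _ => by positivity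
    -- The geometric tail equals `4 / 3` for `t = 1 / 2`, and `√2 / 3 < 0.4715`.
    have h5 : 1 / 4 * √2 * K * E ≤ 0.4715 * K * T := by
      have e1 : (1 / 2 : ℝ) / ((1 - 1 / 2) * (1 - (1 / 2) ^ 2)) = 4 / 3 := by norm_num
      rw [e1] at h3
      have e2 : √2 * E ≤ 1.4143 * (T * (4 / 3)) := mul_le_mul h2 h3 hE0 (by norm_num)
      have e3 := mul_le_mul_of_nonneg_left e2 hK
      have e4 : 0 ≤ K * T := by positivity
      linarith
    have h6 : c / 3 / ((k : ℝ) + 1) ≤ c * T := by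
      rw [div_div, div_le_iff₀ (by positivity)]
      push_cast at h4
      have : c * 1 ≤ c * (T * (3 * (k + 1))) := by gcongr; linarith
      linarith
    have : c * T = S * T - η * T - 0.4715 * K * T := by rw [hc]; ring
    linarith
  have h3 : 1 / (1 - Real.exp (-(1 / 4))) * X ≤ 1 / 0.221 * X := by gcongr
  have h4 : ∑ k ∈ Icc 1 N, ‖a k‖ * (c / 3 / ((k : ℝ) + 1)) =
      c / 3 * ∑ k ∈ Icc 1 N, ‖a k‖ / ((k : ℝ) + 1) := by
    rw [mul_sum]; exact sum_congr rfl fun k _ => by ring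
  rw [h4] at h1
  have h5 := h1.trans h3
  rw [one_div, inv_mul_eq_div, le_div_iff₀ (by norm_num)] at h5
  linarith

/-! ### Integer frequencies -/

/-- For integer frequencies and the weight `1` there is no interaction at all. The factor `1.001`
stands for any bound larger than `1` for the normalised `L²` norms of the blocks. -/
lemma integer_lower_bound {N p J : ℕ} (hp : 1 ≤ p) {n : ℕ → ℤ} (hn : StrictMonoOn n (Set.Icc 1 N))
    (a : ℕ → ℂ) {ε t : ℝ} (hε : 0 < ε) (ht0 : 0 < t) (ht : t ^ 2 * (p + 1) = 1) :
    ∑ k ∈ Icc 1 N, ‖a k‖ *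
        ((if blockIndex p k ≤ J then 1 * t ^ (2 * blockIndex p k) else 0)
          - 0 * t ^ (2 * blockIndex p k)
          - ε * √2 * 1.001 * ∑ j ∈ Icc (blockIndex p k) J, ∑ i ∈ Ioc j J, t ^ j * t ^ i) ≤
      1 / (1 - Real.exp (-ε)) *
        ∫ s in (-(1 / 2) : ℝ)..(1 / 2), ‖∑ k ∈ Icc 1 N, a k * ch (n k * s)‖ := by
  have hsub : ∀ k l : ℕ, (n k : ℝ) - n l = ((n k - n l : ℤ) : ℝ) := fun k l => by push_cast; ring
  have h1 : ∫ s in (-(1 / 2) : ℝ)..(1 / 2), (fun _ => 1 : ℝ → ℝ) s = 1 := by norm_num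
  have key := weighted_lower_bound (N := N) (J := J) (blk := blockIndex p) (t := t) (ε := ε)
    (K := 1.001) (η := 0) (μ := fun k => n k) (w := fun _ => 1) (δ := fun _ _ => 0) a ht0 hε le_rfl
    (card_block_mul_pow_le hp ht N) (fun k l => lt_of_blockIndex_lt) continuous_const (fun _ => by norm_num)
    (fun _ => le_rfl) (fun k _ => ?_) (fun k hk l hl hkl => ?_) (fun k hk l hl hkl P M _ => ?_)
    (fun k _ => ?_) (by norm_num)
  · rw [h1] at key
    exact key
  · have := ch_add (-(n k * (1 / 2))) (n k)
    rw [ch_int, mul_one] at this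
    rw [← this]
    congr 2; ring
  · simp only [Complex.ofReal_one, one_mul, hsub]
    rw [integral_ch_int, norm_zero]
    exact sub_ne_zero.mpr (hn.injOn.ne (by simpa using hk) (by simpa using hl) hkl)
  · simp only [Complex.ofReal_one, one_mul, hsub, mul_zero]
    rw [integral_mul_polynomial_ch (by fun_prop)]
    rw [sum_eq_zero, norm_zero]
    intro m _
    have h2 : ∀ s : ℝ, ch (((n k - n l : ℤ) : ℝ) * s) * ch (m * s) =
        ch (((n k - n l + m : ℤ) : ℝ) * s) := by
      intro s; rw [← ch_add]; congr 1; push_cast; ring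
    simp_rw [h2]
    rw [integral_ch_int, mul_zero]
    have := hn (by simpa using hl) (by simpa using hk) hkl
    omega
  · simp

theorem integer_sum_div_le {N : ℕ} {n : ℕ → ℤ} (hn : StrictMonoOn n (Set.Icc 1 N)) (a : ℕ → ℂ) :
    1 / 26 * ∑ k ∈ Icc 1 N, ‖a k‖ / ((k : ℝ) + 1) ≤
      ∫ s in (-(1 / 2) : ℝ)..(1 / 2), ‖∑ k ∈ Icc 1 N, a k * ch (n k * s)‖ := by
  have h := sum_div_succ_le (N := N) (a := a) (S := 1) (η := 0) (K := 1.001) (by norm_num)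
    (intervalIntegral.integral_nonneg (by norm_num) fun s _ => norm_nonneg _) (by norm_num)
    (integer_lower_bound (p := 3) (J := blockIndex 3 N) (by norm_num) hn a
      (ε := 1 / 4) (t := 1 / 2) (by norm_num) (by norm_num) (by norm_num))
  refine le_trans ?_ h
  gcongr
  norm_num

lemma exp_neg_le : Real.exp (-1.55) ≤ 1 / 4.7 := by
  rw [Real.exp_neg]
  have := Real.sum_le_exp_of_nonneg (show (0 : ℝ) ≤ 1.55 by norm_num) 8
  simp only [sum_range_succ, range_zero, sum_empty] at this
  norm_num [Nat.factorial] at this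
  rw [inv_le_comm₀ (Real.exp_pos _) (by norm_num)]
  norm_num
  linarith

lemma log_eighty_one_le : Real.log 81 ≤ 4.4 := by
  have h3 : Real.log 3 ≤ 1.1 := by
    rw [Real.log_le_iff_le_exp (by norm_num)]
    have := Real.sum_le_exp_of_nonneg (show (0 : ℝ) ≤ 1.1 by norm_num) 8
    simp only [sum_range_succ, range_zero, sum_empty] at this
    norm_num [Nat.factorial] at this
    norm_num
    linarith
  rw [show (81 : ℝ) = 3 ^ 4 by norm_num, Real.log_pow]
  push_cast; linarith

lemma four_div_pi_pow_three_le : 4 / Real.pi ^ 3 ≤ 0.12902 := by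
  rw [div_le_iff₀ (by positivity)]
  have : (3.1415 : ℝ) ^ 3 ≤ Real.pi ^ 3 := by gcongr; exact Real.pi_gt_d4.le
  linarith [show (4 : ℝ) ≤ 0.12902 * 3.1415 ^ 3 by norm_num]

/-- With blocks of sizes `81ʲ` and `ε = 1.55`, each complete block contributes more than
`(4 / π³) log 81`; the last one is not damped, which pays for the incomplete remainder. -/
theorem integer_log_le {N : ℕ} {n : ℕ → ℤ} (hn : StrictMonoOn n (Set.Icc 1 N)) {a : ℕ → ℂ}
    (ha : ∀ k ∈ Icc 1 N, 1 ≤ ‖a k‖) :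
    4 / Real.pi ^ 3 * Real.log N ≤
      ∫ s in (-(1 / 2) : ℝ)..(1 / 2), ‖∑ k ∈ Icc 1 N, a k * ch (n k * s)‖ := by
  set X := ∫ s in (-(1 / 2) : ℝ)..(1 / 2), ‖∑ k ∈ Icc 1 N, a k * ch (n k * s)‖ with hX
  have hX0 : 0 ≤ X := intervalIntegral.integral_nonneg (by norm_num) fun s _ => norm_nonneg _
  rcases Nat.eq_zero_or_pos N with h0 | hN
  · rw [h0]; simpa using hX0
  -- The blocks `0, …, J` are the complete ones; the indices beyond them are not used.
  obtain ⟨J, hJ⟩ : ∃ J, blockIndex 80 (N + 1) = J + 1 := by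
    refine Nat.exists_eq_add_one.mpr (Nat.log_pos (by norm_num) ?_)
    omega
  have hmain := integer_lower_bound (p := 80) (J := J) (by norm_num) hn a
      (ε := 1.55) (t := 1 / 9) (by norm_num) (by norm_num) (by norm_num)
  have h2 : √2 ≤ 1.4143 := by rw [Real.sqrt_le_left (by norm_num)]; norm_num
  have he := exp_neg_le
  -- The weight of an index in the `m`-th block: the loss `0.2778` from damping bounds
  -- `1.55 * √2 * 1.001 * (81 / 640)`, and the last block in use suffers none.
  have hcoef : ∀ m ≤ J, (if m = J then (1 : ℝ) else 0.7222) * (1 / 9) ^ (2 * m) ≤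
      1 * (1 / 9) ^ (2 * m) - 0 * (1 / 9) ^ (2 * m) -
        1.55 * √2 * 1.001 * ∑ j ∈ Icc m J, ∑ i ∈ Ioc j J, (1 / 9 : ℝ) ^ j * (1 / 9) ^ i := by
    intro m hm
    split_ifs with h
    · subst h; simp
    · have h3 := sum_tail_le (t := 1 / 9) (by norm_num) (by norm_num) m J
      set E := ∑ j ∈ Icc m J, ∑ i ∈ Ioc j J, (1 / 9 : ℝ) ^ j * (1 / 9) ^ i with hE
      have hE0 : 0 ≤ E := sum_nonneg fun j _ => sum_nonneg fun i _ => by positivity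
      have e1 : (1 / 9 : ℝ) / ((1 - 1 / 9) * (1 - (1 / 9) ^ 2)) = 81 / 640 := by norm_num
      rw [e1] at h3
      have e2 : √2 * E ≤ 1.4143 * ((1 / 9) ^ (2 * m) * (81 / 640)) :=
        mul_le_mul h2 h3 hE0 (by norm_num)
      have e3 : (0 : ℝ) ≤ (1 / 9) ^ (2 * m) := by positivity
      linarith
  have hlow : 0.7222 * (J : ℝ) + 1 ≤ ∑ k ∈ Icc 1 N, ‖a k‖ *
        ((if blockIndex 80 k ≤ J then 1 * (1 / 9) ^ (2 * blockIndex 80 k) else 0)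
          - 0 * (1 / 9) ^ (2 * blockIndex 80 k)
          - 1.55 * √2 * 1.001 *
            ∑ j ∈ Icc (blockIndex 80 k) J, ∑ i ∈ Ioc j J, (1 / 9 : ℝ) ^ j * (1 / 9) ^ i) := by
    calc 0.7222 * (J : ℝ) + 1 = ∑ m ∈ range (J + 1), (if m = J then (1 : ℝ) else 0.7222) := by
          rw [sum_range_succ, if_pos rfl, sum_congr rfl fun m hm =>
            if_neg (by rw [mem_range] at hm; omega), sum_const, card_range, nsmul_eq_mul]
          ring
      _ = ∑ m ∈ range (J + 1), ∑ k ∈ {k ∈ Icc 1 N | blockIndex 80 k = m},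
            (if m = J then (1 : ℝ) else 0.7222) * (1 / 9) ^ (2 * m) := by
          refine sum_congr rfl fun m hm => ?_
          rw [mem_range] at hm
          rw [sum_const, card_block_eq (by norm_num) (by omega), nsmul_eq_mul]
          have := pow_two_mul_eq (p := 80) (t := 1 / 9) (by norm_num) m
          push_cast at this ⊢
          linear_combination (-(if m = J then (1 : ℝ) else 0.7222)) * this
      _ = ∑ m ∈ range (J + 1), ∑ k ∈ {k ∈ Icc 1 N | blockIndex 80 k = m},
            (if blockIndex 80 k ≤ J then (if blockIndex 80 k = J then (1 : ℝ) else 0.7222) *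
              (1 / 9) ^ (2 * blockIndex 80 k) else 0) := by
          refine sum_congr rfl fun m hm => sum_congr rfl fun k hk => ?_
          rw [(mem_filter.mp hk).2]
          exact (if_pos (Nat.lt_succ_iff.mp (mem_range.mp hm))).symm
      _ ≤ ∑ k ∈ Icc 1 N,
            (if blockIndex 80 k ≤ J then (if blockIndex 80 k = J then (1 : ℝ) else 0.7222) *
              (1 / 9) ^ (2 * blockIndex 80 k) else 0) := by
          refine sum_fiberwise_le_sum_of_sum_fiber_nonneg fun m _ => sum_nonneg fun k _ => ?_
          positivity
      _ ≤ _ := by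
          refine sum_le_sum fun k hk => ?_
          by_cases h1 : blockIndex 80 k ≤ J
          · have h3 := hcoef _ h1
            rw [if_pos h1, if_pos h1]
            refine h3.trans (le_mul_of_one_le_left (le_trans ?_ h3) (ha k hk))
            positivity
          · rw [if_neg h1, if_neg h1, Icc_eq_empty h1]; simp
  have hlog : Real.log N ≤ (J + 1) * 4.4 + 1 / 80 := by
    have h1 : 80 * (N + 1) < 81 ^ (J + 2) := by
      have := Nat.lt_pow_succ_log_self (b := 80 + 1) (by norm_num) (80 * (N + 1))
      change _ < _ ^ (blockIndex 80 (N + 1) + 1) at this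
      rwa [hJ] at this
    have h3 : (N : ℝ) ≤ 81 ^ (J + 1) * (81 / 80) := by
      have h4 : (80 : ℝ) * (N + 1) < 81 ^ (J + 2) := by exact_mod_cast h1
      rw [pow_succ] at h4
      linarith
    have h4 : Real.log N ≤ Real.log (81 ^ (J + 1) * (81 / 80)) :=
      Real.log_le_log (by exact_mod_cast hN) h3
    rw [Real.log_mul (by positivity) (by norm_num), Real.log_pow] at h4
    have h5 := Real.log_le_sub_one_of_pos (show (0 : ℝ) < 81 / 80 by norm_num)
    have h6 : ((J + 1 : ℕ) : ℝ) * Real.log 81 ≤ ((J + 1 : ℕ) : ℝ) * 4.4 := by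
      gcongr; exact log_eighty_one_le
    push_cast at h4 h6
    linarith
  have hB : 1 / (1 - Real.exp (-1.55)) * X ≤ 1 / (1 - 1 / 4.7) * X := by
    gcongr
  have h5 := hlow.trans (hmain.trans hB)
  have h6 : (0.7222 * (J : ℝ) + 1) * (1 - 1 / 4.7) ≤ X := by
    rw [one_div_mul_eq_div, le_div_iff₀ (by norm_num)] at h5
    exact h5
  have h7 : 4 / Real.pi ^ 3 * Real.log N ≤ 0.12902 * ((J + 1) * 4.4 + 1 / 80) :=
    mul_le_mul four_div_pi_pow_three_le hlog (Real.log_natCast_nonneg N) (by norm_num)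
  have hJ0 : (0 : ℝ) ≤ J := Nat.cast_nonneg J
  refine h7.trans (le_trans ?_ h6)
  norm_num
  linarith

/-! ### Means of almost periodic functions -/

lemma trigPoly_eq (N : ℕ) (freq : ℕ → ℝ) (a : ℕ → ℂ) (t : ℝ) :
    trigPoly N freq a t = ∑ k ∈ Icc 1 N, a k * ch (freq k * t) := by
  refine sum_congr rfl fun k _ => ?_
  rw [ch]; congr 2; push_cast; ring

lemma continuous_trigPoly (N : ℕ) (freq : ℕ → ℝ) (a : ℕ → ℂ) : Continuous (trigPoly N freq a) := by
  simp_rw [funext (trigPoly_eq N freq a)]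
  fun_prop

lemma absMean_trigPoly_eq (N : ℕ) (freq : ℕ → ℝ) (a : ℕ → ℂ) {T : ℝ} (hT : 0 < T) :
    absMean (trigPoly N freq a) T =
      ∫ s in (-(1 / 2) : ℝ)..(1 / 2), ‖∑ k ∈ Icc 1 N, a k * ch (T * freq k * s)‖ := by
  have h := intervalIntegral.integral_comp_mul_left (a := -(1 / 2)) (b := 1 / 2)
    (fun t => ‖trigPoly N freq a t‖) hT.ne'
  rw [absMean, show -(T / 2) = T * -(1 / 2) by ring, show T / 2 = T * (1 / 2) by ring, one_div,
    ← smul_eq_mul, ← h]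
  simp_rw [trigPoly_eq]
  congr 1; ext s; congr 1
  refine sum_congr rfl fun k _ => ?_
  congr 2; ring

/-- A complex function on the line has a mean value. -/
def HasMean (f : ℝ → ℂ) : Prop :=
  ∃ L : ℂ, Filter.Tendsto (fun T : ℝ => ((1 / T : ℝ) : ℂ) * ∫ t in (-(T / 2))..(T / 2), f t)
    Filter.atTop (nhds L)

lemma hasMean_ch (x : ℝ) : HasMean fun t => ch (x * t) := by
  rcases eq_or_ne x 0 with rfl | hx
  · refine ⟨1, tendsto_const_nhds.congr' ?_⟩
    filter_upwards [Filter.eventually_gt_atTop 0] with T hT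
    simp only [zero_mul, ch_zero, intervalIntegral.integral_const]
    rw [show T / 2 - -(T / 2) = T by ring, Complex.real_smul, mul_one, ← Complex.ofReal_mul,
      one_div_mul_cancel hT.ne', Complex.ofReal_one]
  · refine ⟨0, ?_⟩
    rw [tendsto_zero_iff_norm_tendsto_zero]
    have h1 : Filter.Tendsto (fun T : ℝ => T⁻¹ * (1 / |Real.pi * x|)) Filter.atTop (nhds 0) := by
      simpa using tendsto_inv_atTop_zero.mul_const (1 / |Real.pi * x|)
    refine squeeze_zero' (Filter.Eventually.of_forall fun _ => norm_nonneg _) ?_ h1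
    filter_upwards [Filter.eventually_gt_atTop 0] with T hT
    rw [integral_ch_mul hx, norm_mul, Complex.norm_real, Complex.norm_real, Real.norm_eq_abs,
      Real.norm_eq_abs, abs_of_pos (by positivity), abs_div, one_div]
    gcongr
    exact Real.abs_sin_le_one _

lemma hasMean_of_mem_span {f : ℝ → ℂ}
    (hf : f ∈ Submodule.span ℂ (Set.range fun (x : ℝ) (t : ℝ) => ch (x * t))) :
    Continuous f ∧ HasMean f := by
  induction hf using Submodule.span_induction with
  | mem f hf =>
    obtain ⟨x, rfl⟩ := hf
    exact ⟨by fun_prop, hasMean_ch x⟩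
  | zero => exact ⟨continuous_const, 0, by simp⟩
  | add f g _ _ hf hg =>
    obtain ⟨hfc, L, hL⟩ := hf
    obtain ⟨hgc, M, hM⟩ := hg
    refine ⟨hfc.add hgc, L + M, (hL.add hM).congr fun T => ?_⟩
    rw [← mul_add, ← intervalIntegral.integral_add (hfc.intervalIntegrable _ _)
      (hgc.intervalIntegrable _ _)]
    rfl
  | smul c f _ hf =>
    obtain ⟨hfc, L, hL⟩ := hf
    refine ⟨hfc.const_smul c, c * L, (hL.const_mul c).congr fun T => ?_⟩
    simp only [Pi.smul_apply, smul_eq_mul]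
    rw [intervalIntegral.integral_const_mul]; ring

/-- The algebra generated by the characters is their span. -/
lemma mem_span_of_mem_adjoin {f : ℝ → ℂ}
    (hf : f ∈ Algebra.adjoin ℂ (Set.range fun (x : ℝ) (t : ℝ) => ch (x * t))) :
    f ∈ Submodule.span ℂ (Set.range fun (x : ℝ) (t : ℝ) => ch (x * t)) := by
  let S : Submonoid (ℝ → ℂ) :=
    { carrier := Set.range fun (x : ℝ) (t : ℝ) => ch (x * t)
      one_mem' := ⟨0, by ext t; simp [ch_zero]⟩
      mul_mem' := by
        rintro _ _ ⟨x, rfl⟩ ⟨y, rfl⟩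
        exact ⟨x + y, by ext t; simp [add_mul, ch_add]⟩ }
  rw [← Subalgebra.mem_toSubmodule, Algebra.adjoin_eq_span] at hf
  change f ∈ Submodule.span ℂ (Submonoid.closure (S : Set (ℝ → ℂ)) : Set (ℝ → ℂ)) at hf
  rwa [Submonoid.closure_eq] at hf

lemma norm_trigPoly_le (N : ℕ) (freq : ℕ → ℝ) (a : ℕ → ℂ) (t : ℝ) :
    ‖trigPoly N freq a t‖ ≤ ∑ k ∈ Icc 1 N, ‖a k‖ := by
  rw [trigPoly_eq]
  exact norm_sum_le_of_le _ fun k _ => by rw [norm_mul, norm_ch, mul_one]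

/-- The modulus of a trigonometric polynomial is a uniform limit of trigonometric polynomials:
approximate the square root by polynomials and apply it to `|φ|²`. -/
lemma exists_hasMean_approx (N : ℕ) (freq : ℕ → ℝ) (a : ℕ → ℂ) {η : ℝ} (hη : 0 < η) :
    ∃ f : ℝ → ℂ, Continuous f ∧ HasMean f ∧ ∀ t, ‖(‖trigPoly N freq a t‖ : ℂ) - f t‖ ≤ η := by
  set A := Algebra.adjoin ℂ (Set.range fun (x : ℝ) (t : ℝ) => ch (x * t)) with hA
  have hch : ∀ x : ℝ, (fun t : ℝ => ch (x * t)) ∈ A := fun x =>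
    Algebra.subset_adjoin ⟨x, rfl⟩
  have h1 : trigPoly N freq a ∈ A := by
    have : trigPoly N freq a = ∑ k ∈ Icc 1 N, a k • fun t : ℝ => ch (freq k * t) := by
      ext t; rw [trigPoly_eq]; simp
    rw [this]
    exact sum_mem fun k _ => A.smul_mem (hch _) _
  have h2 : (fun t => (starRingEnd ℂ) (trigPoly N freq a t)) ∈ A := by
    have : (fun t => (starRingEnd ℂ) (trigPoly N freq a t)) =
        ∑ k ∈ Icc 1 N, (starRingEnd ℂ) (a k) • fun t : ℝ => ch (-freq k * t) := by
      ext t; rw [trigPoly_eq]; simp [ch_neg]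
    rw [this]
    exact sum_mem fun k _ => A.smul_mem (hch _) _
  have h3 : (fun t => ((‖trigPoly N freq a t‖ ^ 2 : ℝ) : ℂ)) ∈ A := by
    have := A.mul_mem h2 h1
    convert this using 1
    ext t
    rw [Pi.mul_apply, Complex.conj_mul']; push_cast; rfl
  set R := ∑ k ∈ Icc 1 N, ‖a k‖
  obtain ⟨p, hp⟩ := exists_polynomial_near_of_continuousOn 0 (R ^ 2) Real.sqrt
    Real.continuous_sqrt.continuousOn η hη
  have h4 : (fun t => ((p.eval (‖trigPoly N freq a t‖ ^ 2) : ℝ) : ℂ)) ∈ A := by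
    have h5 : (fun t => ((p.eval (‖trigPoly N freq a t‖ ^ 2) : ℝ) : ℂ)) =
        ∑ i ∈ range (p.natDegree + 1),
          (p.coeff i : ℂ) • (fun t => ((‖trigPoly N freq a t‖ ^ 2 : ℝ) : ℂ)) ^ i := by
      ext t
      rw [Polynomial.eval_eq_sum_range]
      simp
    rw [h5]
    exact sum_mem fun i _ => A.smul_mem (A.pow_mem h3 i) _
  obtain ⟨h5, h6⟩ := hasMean_of_mem_span (mem_span_of_mem_adjoin h4)
  refine ⟨_, h5, h6, fun t => ?_⟩
  have h7 := hp (‖trigPoly N freq a t‖ ^ 2) ⟨by positivity, by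
    gcongr; exact norm_trigPoly_le N freq a t⟩
  rw [Real.sqrt_sq (norm_nonneg _), abs_sub_comm] at h7
  rw [← Complex.ofReal_sub, Complex.norm_real, Real.norm_eq_abs]
  exact h7.le

lemma exists_tendsto_absMean (N : ℕ) (freq : ℕ → ℝ) (a : ℕ → ℂ) :
    ∃ L : ℝ, Filter.Tendsto (absMean (trigPoly N freq a)) Filter.atTop (nhds L) := by
  refine cauchySeq_tendsto_of_complete (Metric.cauchySeq_iff'.mpr fun ε hε => ?_)
  obtain ⟨f, hfc, ⟨L, hL⟩, hf⟩ := exists_hasMean_approx N freq a (η := ε / 4) (by positivity)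
  have hclose : ∀ T : ℝ, 0 < T → ‖((absMean (trigPoly N freq a) T : ℝ) : ℂ) -
      ((1 / T : ℝ) : ℂ) * ∫ t in (-(T / 2))..(T / 2), f t‖ ≤ ε / 4 := by
    intro T hT
    have hc := continuous_trigPoly N freq a
    rw [absMean, Complex.ofReal_mul, ← intervalIntegral.integral_ofReal, ← mul_sub,
      ← intervalIntegral.integral_sub ((by fun_prop : Continuous _).intervalIntegrable _ _)
        (hfc.intervalIntegrable _ _), norm_mul, Complex.norm_real, Real.norm_eq_abs,
      abs_of_pos (by positivity)]
    have h1 := intervalIntegral.norm_integral_le_of_norm_le_const (a := -(T / 2)) (b := T / 2)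
      (f := fun t => (‖trigPoly N freq a t‖ : ℂ) - f t) (C := ε / 4) fun t _ => hf t
    rw [show T / 2 - -(T / 2) = T by ring, abs_of_pos hT] at h1
    calc _ ≤ 1 / T * (ε / 4 * T) := by gcongr
      _ = ε / 4 := by field_simp
  obtain ⟨T₀, hT₀⟩ := Filter.eventually_atTop.mp
    ((Metric.tendsto_nhds.mp hL (ε / 8) (by positivity)).and (Filter.eventually_gt_atTop 0))
  refine ⟨T₀, fun T hT => ?_⟩
  obtain ⟨h1, h2⟩ := hT₀ T hT
  obtain ⟨h3, h4⟩ := hT₀ T₀ le_rfl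
  have h5 := hclose T h2
  have h6 := hclose T₀ h4
  rw [← dist_eq_norm] at h5 h6
  rw [dist_comm] at h3 h6
  have h7 : dist (absMean (trigPoly N freq a) T) (absMean (trigPoly N freq a) T₀) =
      dist ((absMean (trigPoly N freq a) T : ℝ) : ℂ) ((absMean (trigPoly N freq a) T₀ : ℝ) : ℂ) :=
    (Complex.isometry_ofReal.dist_eq _ _).symm
  rw [h7]
  have h9 := dist_triangle4 ((absMean (trigPoly N freq a) T : ℝ) : ℂ)
    (((1 / T : ℝ) : ℂ) * ∫ t in (-(T / 2))..(T / 2), f t)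
    (((1 / T₀ : ℝ) : ℂ) * ∫ t in (-(T₀ / 2))..(T₀ / 2), f t)
    ((absMean (trigPoly N freq a) T₀ : ℝ) : ℂ)
  have h8 := dist_triangle (((1 / T : ℝ) : ℂ) * ∫ t in (-(T / 2))..(T / 2), f t) L
    (((1 / T₀ : ℝ) : ℂ) * ∫ t in (-(T₀ / 2))..(T₀ / 2), f t)
  linarith

/-! ### Reduction of the mean to integer frequencies -/

/-- Simultaneous Diophantine approximation with arbitrarily large denominators. -/
lemma exists_large_near_int (N : ℕ) (freq : ℕ → ℝ) {ε : ℝ} (hε : 0 < ε) (T₀ : ℝ) :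
    ∃ T ≥ T₀, ∃ n : ℕ → ℤ, ∀ k ∈ Icc 1 N, |T * freq k - n k| ≤ ε := by
  let x : ℕ → Fin (N + 1) → UnitAddCircle := fun m k => ((m * freq k : ℝ) : UnitAddCircle)
  obtain ⟨_, φ, hφ, hlim⟩ := CompactSpace.tendsto_subseq x
  obtain ⟨M, hM⟩ := Metric.cauchySeq_iff.mp hlim.cauchySeq ε hε
  let j := max M (φ M + ⌈T₀⌉₊)
  have hj : φ M + ⌈T₀⌉₊ ≤ φ j := (le_max_right _ _).trans hφ.le_apply
  refine ⟨(φ j : ℝ) - φ M, ?_, fun k => round (((φ j : ℝ) - φ M) * freq k), fun k hk => ?_⟩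
  · have h1 : (φ M : ℝ) + ⌈T₀⌉₊ ≤ φ j := by exact_mod_cast hj
    linarith [Nat.le_ceil T₀]
  · have h1 := hM j (le_max_left _ _) M le_rfl
    have hk' : k < N + 1 := by rw [mem_Icc] at hk; omega
    have h2 := (dist_le_pi_dist _ _ (⟨k, hk'⟩ : Fin (N + 1))).trans h1.le
    simp only [Function.comp_apply, x] at h2
    rw [dist_eq_norm, ← AddCircle.coe_sub, UnitAddCircle.norm_eq, ← sub_mul] at h2
    exact h2

/-- A lower bound valid for all integer frequencies passes to the mean for real frequencies: on a
well chosen long interval `[-T/2, T/2]`, all the `T * freq k` are almost integers. -/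
lemma le_of_tendsto_absMean {N : ℕ} {freq : ℕ → ℝ} (hfreq : StrictMonoOn freq (Set.Icc 1 N))
    {a : ℕ → ℂ} {L X : ℝ}
    (hL : Filter.Tendsto (absMean (trigPoly N freq a)) Filter.atTop (nhds L))
    (hX : ∀ n : ℕ → ℤ, StrictMonoOn n (Set.Icc 1 N) →
      X ≤ ∫ s in (-(1 / 2) : ℝ)..(1 / 2), ‖∑ k ∈ Icc 1 N, a k * ch (n k * s)‖) : X ≤ L := by
  set R := ∑ k ∈ Icc 1 N, ‖a k‖ with hR
  have hsep : ∀ᶠ T : ℝ in Filter.atTop, ∀ k ∈ Icc 1 N, ∀ l ∈ Icc 1 N, k < l →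
      1 ≤ T * (freq l - freq k) := by
    rw [Filter.eventually_all_finset]; intro k hk
    rw [Filter.eventually_all_finset]; intro l hl
    by_cases hkl : k < l
    · have : 0 < freq l - freq k := by
        have := hfreq (by simpa using hk) (by simpa using hl) hkl
        linarith
      filter_upwards [(Filter.tendsto_id.atTop_mul_const this).eventually_ge_atTop 1] with T hT _
      exact hT
    · exact Filter.Eventually.of_forall fun T h => absurd h hkl
  obtain ⟨T₁, hT₁⟩ := Filter.eventually_atTop.mp hsep
  have key : ∀ ε : ℝ, 0 < ε → ε ≤ 1 / 4 → X - R * (2 * Real.pi * ε) ≤ L := by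
    intro ε hε hε4
    refine ge_of_tendsto_of_frequently hL (Filter.frequently_atTop.mpr fun T₂ => ?_)
    obtain ⟨T, hT, n, hn⟩ := exists_large_near_int N freq hε (max (max T₁ T₂) 1)
    have hTT₁ : T₁ ≤ T := ((le_max_left _ _).trans (le_max_left _ _)).trans hT
    have hTT₂ : T₂ ≤ T := ((le_max_right _ _).trans (le_max_left _ _)).trans hT
    have hT0 : 0 < T := by linarith [(le_max_right (max T₁ T₂) 1).trans hT]
    refine ⟨T, hTT₂, ?_⟩
    have hmono : StrictMonoOn n (Set.Icc 1 N) := by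
      intro k hk l hl hkl
      have h1 := hT₁ T hTT₁ k (by simpa using hk) l (by simpa using hl) hkl
      have h2 := abs_le.mp (hn k (by simpa using hk))
      have h3 := abs_le.mp (hn l (by simpa using hl))
      have : (n k : ℝ) < n l := by linarith [h2.1, h2.2, h3.1, h3.2]
      exact_mod_cast this
    have h1 := hX n hmono
    rw [absMean_trigPoly_eq _ _ _ hT0]
    have h2 : ∫ s in (-(1 / 2) : ℝ)..(1 / 2), ‖∑ k ∈ Icc 1 N, a k * ch (n k * s)‖ ≤
        ∫ s in (-(1 / 2) : ℝ)..(1 / 2),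
          (‖∑ k ∈ Icc 1 N, a k * ch (T * freq k * s)‖ + R * (2 * Real.pi * ε)) := by
      refine intervalIntegral.integral_mono_on (by norm_num)
        ((by fun_prop : Continuous _).intervalIntegrable _ _)
        ((by fun_prop : Continuous _).intervalIntegrable _ _) fun s hs => ?_
      rw [← sub_le_iff_le_add']
      refine (norm_sub_norm_le _ _).trans ?_
      rw [← sum_sub_distrib, hR, sum_mul]
      refine norm_sum_le_of_le _ fun k hk => ?_
      rw [← mul_sub, norm_mul]
      gcongr
      have h3 : ch (T * freq k * s) = ch (n k * s) * ch ((T * freq k - n k) * s) := by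
        rw [← ch_add]; congr 1; ring
      rw [norm_sub_rev, h3, ← mul_sub_one, norm_mul, norm_ch, one_mul]
      refine (norm_ch_sub_one_le _).trans ?_
      gcongr
      rw [abs_mul]
      calc _ ≤ ε * 1 := by
            gcongr
            · exact hn k hk
            · rw [abs_le]; constructor <;> linarith [hs.1, hs.2]
        _ = ε := mul_one ε
    rw [intervalIntegral.integral_add ((by fun_prop : Continuous _).intervalIntegrable _ _)
      ((by fun_prop : Continuous _).intervalIntegrable _ _)] at h2
    norm_num at h2 h1 ⊢
    linarith
  have ht : Filter.Tendsto (fun ε : ℝ => X - R * (2 * Real.pi * ε)) (nhdsWithin 0 (Set.Ioi 0))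
      (nhds X) := by
    have : Continuous fun ε : ℝ => X - R * (2 * Real.pi * ε) := by fun_prop
    simpa using (this.tendsto 0).mono_left nhdsWithin_le_nhds
  refine le_of_tendsto ht ?_
  filter_upwards [Ioc_mem_nhdsGT (show (0 : ℝ) < 1 / 4 by norm_num)] with ε hε
  exact key ε hε.1 hε.2

/-! ### The weight `cos² (πs)` -/

lemma integral_cos_sq_mul_ch (x : ℝ) :
    ∫ s in (-(1 / 2) : ℝ)..(1 / 2), ((Real.cos (Real.pi * s) ^ 2 : ℝ) : ℂ) * ch (x * s) =
      1 / 2 * (∫ s in (-(1 / 2) : ℝ)..(1 / 2), ch (x * s)) +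
      1 / 4 * (∫ s in (-(1 / 2) : ℝ)..(1 / 2), ch ((x + 1) * s)) +
      1 / 4 * ∫ s in (-(1 / 2) : ℝ)..(1 / 2), ch ((x - 1) * s) := by
  have h : ∀ s : ℝ, ((Real.cos (Real.pi * s) ^ 2 : ℝ) : ℂ) * ch (x * s) =
      1 / 2 * ch (x * s) + 1 / 4 * ch ((x + 1) * s) + 1 / 4 * ch ((x - 1) * s) := by
    intro s
    have h1 : ((Real.cos (Real.pi * s) ^ 2 : ℝ) : ℂ) = 1 / 2 + 1 / 4 * ch s + 1 / 4 * ch (-s) := by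
      rw [Real.cos_sq, ch, ch]
      push_cast
      rw [Complex.cos]
      have e1 : (2 * (Real.pi * s) * Complex.I : ℂ) = 2 * Real.pi * s * Complex.I := by ring
      have e2 : (-(2 * (Real.pi * s)) * Complex.I : ℂ) = 2 * Real.pi * -s * Complex.I := by ring
      rw [e1, e2]
      ring
    rw [h1, add_mul x, sub_mul x, sub_eq_add_neg, ch_add, ch_add, one_mul]
    ring
  simp_rw [h]
  rw [intervalIntegral.integral_add ((by fun_prop : Continuous _).intervalIntegrable _ _)
      ((by fun_prop : Continuous _).intervalIntegrable _ _),
    intervalIntegral.integral_add ((by fun_prop : Continuous _).intervalIntegrable _ _)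
      ((by fun_prop : Continuous _).intervalIntegrable _ _), intervalIntegral.integral_const_mul,
    intervalIntegral.integral_const_mul, intervalIntegral.integral_const_mul]

lemma integral_cos_sq_pi : ∫ s in (-(1 / 2) : ℝ)..(1 / 2), Real.cos (Real.pi * s) ^ 2 = 1 / 2 := by
  have h := integral_cos_sq_mul_ch 0
  have h1 := integral_ch_int (n := 1) (by norm_num)
  have h2 := integral_ch_int (n := -1) (by norm_num)
  push_cast at h1 h2
  simp only [zero_mul, ch_zero, mul_one, zero_add, zero_sub, h1, h2,
    intervalIntegral.integral_const, intervalIntegral.integral_ofReal] at h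
  norm_num at h
  have h3 : ((∫ s in (-(1 / 2) : ℝ)..(1 / 2), Real.cos (Real.pi * s) ^ 2 : ℝ) : ℂ) =
      ((1 / 2 : ℝ) : ℂ) := by
    push_cast; rw [← h]
  exact_mod_cast h3

/-- Cubic decay of the Fourier transform of `cos² (πs)` on `[-1/2, 1/2]`. -/
lemma norm_integral_cos_sq_mul_ch_le {x : ℝ} (hx : 1 < |x|) :
    ‖∫ s in (-(1 / 2) : ℝ)..(1 / 2), ((Real.cos (Real.pi * s) ^ 2 : ℝ) : ℂ) * ch (x * s)‖ ≤
      1 / (6 * (|x| * (x ^ 2 - 1))) := by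
  have hx0 : x ≠ 0 := by rintro rfl; norm_num at hx
  have hxp : x + 1 ≠ 0 := by
    intro h; rw [show x = -1 by linarith] at hx; norm_num at hx
  have hxm : x - 1 ≠ 0 := by
    intro h; rw [show x = 1 by linarith] at hx; norm_num at hx
  have hsq : 0 < x ^ 2 - 1 := by
    have := one_lt_sq_iff_one_lt_abs x |>.mpr hx
    linarith
  have hpi : Real.pi ≠ 0 := Real.pi_ne_zero
  rw [integral_cos_sq_mul_ch, integral_ch_mul hx0, integral_ch_mul hxp, integral_ch_mul hxm]
  have e1 : 2 * Real.pi * x * (1 / 2) = Real.pi * x := by ring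
  have e2 : 2 * Real.pi * (x + 1) * (1 / 2) = Real.pi * x + Real.pi := by ring
  have e3 : 2 * Real.pi * (x - 1) * (1 / 2) = Real.pi * x - Real.pi := by ring
  rw [e1, e2, e3, Real.sin_add_pi, Real.sin_sub_pi]
  have e4 : (1 / 2 * ((Real.sin (Real.pi * x) / (Real.pi * x) : ℝ) : ℂ) +
      1 / 4 * ((-Real.sin (Real.pi * x) / (Real.pi * (x + 1)) : ℝ) : ℂ) +
      1 / 4 * ((-Real.sin (Real.pi * x) / (Real.pi * (x - 1)) : ℝ) : ℂ)) =
      ((-Real.sin (Real.pi * x) / (2 * Real.pi * (x * (x ^ 2 - 1))) : ℝ) : ℂ) := by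
    have : (1 / 2 * (Real.sin (Real.pi * x) / (Real.pi * x)) +
      1 / 4 * (-Real.sin (Real.pi * x) / (Real.pi * (x + 1))) +
      1 / 4 * (-Real.sin (Real.pi * x) / (Real.pi * (x - 1)))) =
      -Real.sin (Real.pi * x) / (2 * Real.pi * (x * (x ^ 2 - 1))) := by
      have : x ^ 2 - 1 = (x + 1) * (x - 1) := by ring
      rw [this]
      field_simp
      ring
    rw [← this]; push_cast; ring
  rw [e4, Complex.norm_real, Real.norm_eq_abs, abs_div, abs_neg, abs_mul, abs_mul x,
    abs_of_pos hsq, abs_of_pos (by positivity : 0 < 2 * Real.pi)]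
  have h3 := Real.pi_gt_three
  gcongr
  · exact Real.abs_sin_le_one _
  · linarith

lemma sum_inv_mul_sq_sub_one_le {y : ℝ} (hy : 1 < y) (M : ℕ) :
    ∑ m ∈ range M, 1 / (6 * (|y + m| * ((y + m) ^ 2 - 1))) ≤ 1 / (12 * (y * (y - 1))) := by
  have h : ∑ m ∈ range M, 1 / (6 * (|y + m| * ((y + m) ^ 2 - 1))) =
      1 / (12 * (y * (y - 1))) - 1 / (12 * ((y + M) * (y + M - 1))) := by
    induction M with
    | zero => simp
    | succ M ih =>
      have hM : (0 : ℝ) ≤ M := Nat.cast_nonneg M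
      have h1 : y + M ≠ 0 := by linarith
      have h2 : y + M - 1 ≠ 0 := by linarith
      have h3 : y + M + 1 ≠ 0 := by linarith
      rw [sum_range_succ, ih, abs_of_pos (by linarith)]
      have e : (y + M) ^ 2 - 1 = (y + M + 1) * (y + M - 1) := by ring
      have e1 : y + ((M + 1 : ℕ) : ℝ) = y + M + 1 := by push_cast; ring
      rw [e, e1, add_sub_cancel_right, sub_add, sub_right_inj]
      field_simp
      ring
  rw [h]
  have hM : (0 : ℝ) ≤ M := Nat.cast_nonneg M
  have : 0 ≤ 1 / (12 * ((y + M) * (y + M - 1))) := by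
    have : 0 < y + M - 1 := by linarith
    positivity
  linarith

/-- Against an analytic polynomial, whose frequencies add to `y > 1`, the weight `cos² (πs)` still
gives quadratic decay. -/
lemma norm_integral_cos_sq_mul_polynomial_le {y M : ℝ} (hy : 1 < y) {P : Polynomial ℂ}
    (hP : ∀ s ∈ Set.Icc (-(1 / 2) : ℝ) (1 / 2), ‖P.eval (ch s)‖ ≤ M) :
    ‖∫ s in (-(1 / 2) : ℝ)..(1 / 2),
      ((Real.cos (Real.pi * s) ^ 2 : ℝ) : ℂ) * ch (y * s) * P.eval (ch s)‖ ≤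
      M * (1 / (12 * (y * (y - 1)))) := by
  have hM : 0 ≤ M := (norm_nonneg _).trans (hP 0 (by norm_num))
  rw [integral_mul_polynomial_ch (by fun_prop)]
  refine le_trans ?_ (mul_le_mul_of_nonneg_left
    (sum_inv_mul_sq_sub_one_le hy (P.natDegree + 1)) hM)
  rw [mul_sum]
  refine norm_sum_le_of_le _ fun n _ => ?_
  rw [norm_mul]
  have h1 : ∀ s : ℝ, ((Real.cos (Real.pi * s) ^ 2 : ℝ) : ℂ) * ch (y * s) * ch (n * s) =
      ((Real.cos (Real.pi * s) ^ 2 : ℝ) : ℂ) * ch ((y + n) * s) := by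
    intro s; rw [add_mul, ch_add]; ring
  simp_rw [h1]
  have hn : (0 : ℝ) ≤ n := Nat.cast_nonneg n
  have h2 := norm_integral_cos_sq_mul_ch_le (x := y + n) (by rw [abs_of_pos] <;> linarith)
  exact mul_le_mul (norm_coeff_le hP n) h2 (norm_nonneg _) hM

/-! ### Separated frequencies on a bounded interval -/

lemma sum_inv_sq_le (N : ℕ) : ∑ d ∈ Icc 1 N, 1 / (d : ℝ) ^ 2 ≤ 2 := by
  have h := sum_Ioo_inv_sq_le (α := ℝ) 0 (N + 1)
  have h1 : Ioo 0 (N + 1) = Icc 1 N := by ext; simp only [mem_Ioo, mem_Icc]; omega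
  rw [h1] at h
  simpa using h

lemma sum_inv_sub_sq_le {N k : ℕ} (hk : k ∈ Icc 1 N) :
    ∑ l ∈ (Icc 1 N).erase k, 1 / ((k : ℝ) - l) ^ 2 ≤ 4 := by
  rw [mem_Icc] at hk
  have h1 : ∑ l ∈ (Icc 1 N).erase k with l < k, 1 / ((k : ℝ) - l) ^ 2 ≤ 2 := by
    refine le_trans (le_trans (le_of_eq ?_) (sum_le_sum_of_subset_of_nonneg
      (s := ({l ∈ (Icc 1 N).erase k | l < k}).image (k - ·)) (f := fun d : ℕ => 1 / (d : ℝ) ^ 2)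
      (t := Icc 1 N) (fun d hd => ?_) fun d _ _ => by positivity)) (sum_inv_sq_le N)
    · rw [sum_image]
      · refine sum_congr rfl fun l hl => ?_
        rw [Nat.cast_sub (mem_filter.mp hl).2.le]
      · intro x hx y hy hxy
        have := (mem_filter.mp hx).2
        have := (mem_filter.mp hy).2
        simp only at hxy
        omega
    · simp only [mem_image, mem_filter, mem_erase, mem_Icc] at hd ⊢
      omega
  have h2 : ∑ l ∈ (Icc 1 N).erase k with ¬l < k, 1 / ((k : ℝ) - l) ^ 2 ≤ 2 := by
    refine le_trans (le_trans (le_of_eq ?_) (sum_le_sum_of_subset_of_nonneg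
      (s := ({l ∈ (Icc 1 N).erase k | ¬l < k}).image (· - k)) (f := fun d : ℕ => 1 / (d : ℝ) ^ 2)
      (t := Icc 1 N) (fun d hd => ?_) fun d _ _ => by positivity)) (sum_inv_sq_le N)
    · rw [sum_image]
      · refine sum_congr rfl fun l hl => ?_
        rw [Nat.cast_sub (not_lt.mp (mem_filter.mp hl).2), ← neg_sub, neg_sq]
      · intro x hx y hy hxy
        have := (mem_filter.mp hx).2
        have := (mem_filter.mp hy).2
        simp only at hxy
        omega
    · simp only [mem_image, mem_filter, mem_erase, mem_Icc] at hd ⊢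
      omega
  rw [← sum_filter_add_sum_filter_not _ (· < k)]
  linarith

/-- The interaction of well separated frequencies, weighted by the sizes of the blocks. -/
lemma sum_interaction_le {N k : ℕ} (hk : k ∈ Icc 1 N) :
    ∑ l ∈ (Icc 1 N).erase k,
        (1 / 2 : ℝ) ^ (2 * blockIndex 3 l) * (1 / (10000 * ((k : ℝ) - l) ^ 2)) ≤
      0.0028 * (1 / 2) ^ (2 * blockIndex 3 k) := by
  set T : ℝ := (1 / 2) ^ (2 * blockIndex 3 k) with hT
  have hT0 : 0 ≤ T := by positivity
  have hk1 : 1 ≤ k := (mem_Icc.mp hk).1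
  have hterm : ∀ l ∈ (Icc 1 N).erase k,
      (1 / 2 : ℝ) ^ (2 * blockIndex 3 l) * (1 / (10000 * ((k : ℝ) - l) ^ 2)) ≤
        T / 2500 * (3 / 2 * (1 / ((k : ℝ) - l) ^ 2) + 1 / 2 * (1 / (l : ℝ) ^ 2)) := by
    intro l hl
    rw [mem_erase, mem_Icc] at hl
    have hl0 : (0 : ℝ) < l := by exact_mod_cast hl.2.1
    have hd : (k : ℝ) - l ≠ 0 := sub_ne_zero.mpr (by exact_mod_cast hl.1.symm)
    have hd2 : 0 < ((k : ℝ) - l) ^ 2 := by positivity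
    -- `4 ^ blockIndex` is comparable to the index itself.
    have h1 : (1 / 2 : ℝ) ^ (2 * blockIndex 3 l) * l ≤ 4 * k * T := by
      have e1 : 1 ≤ (3 : ℕ) * k * T :=
        one_le_mul_pow_blockIndex (p := 3) (t := 1 / 2) (by norm_num) (by norm_num) hk1
      have e2 : 3 * l < 4 ^ (blockIndex 3 l + 1) :=
        Nat.lt_pow_succ_log_self (b := 3 + 1) (by norm_num) (3 * l)
      have e3 : (3 : ℝ) * l ≤ 4 ^ (blockIndex 3 l + 1) := by exact_mod_cast e2.le
      have e4 := pow_two_mul_eq (p := 3) (t := 1 / 2) (by norm_num) (blockIndex 3 l)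
      push_cast at e1 e4
      norm_num at e4
      rw [pow_succ] at e3
      have e5 : (0 : ℝ) ≤ (1 / 2) ^ (2 * blockIndex 3 l) := by positivity
      have e6 := mul_le_mul_of_nonneg_left e3 e5
      linarith
    have h2 : (k : ℝ) / (l * ((k : ℝ) - l) ^ 2) ≤
        3 / 2 * (1 / ((k : ℝ) - l) ^ 2) + 1 / 2 * (1 / (l : ℝ) ^ 2) := by
      have e1 : 3 / 2 * (1 / ((k : ℝ) - l) ^ 2) + 1 / 2 * (1 / (l : ℝ) ^ 2) -
          (k : ℝ) / (l * ((k : ℝ) - l) ^ 2) = 1 / 2 * (1 / ((k : ℝ) - l) - 1 / l) ^ 2 := by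
        field_simp; ring
      have e2 : 0 ≤ 1 / 2 * (1 / ((k : ℝ) - l) - 1 / l) ^ 2 := by positivity
      linarith
    calc _ ≤ 4 * k * T / l * (1 / (10000 * ((k : ℝ) - l) ^ 2)) := by
          gcongr; rwa [le_div_iff₀ hl0]
      _ = T / 2500 * ((k : ℝ) / (l * ((k : ℝ) - l) ^ 2)) := by field_simp; ring
      _ ≤ _ := by gcongr
  refine (sum_le_sum hterm).trans ?_
  rw [← mul_sum, sum_add_distrib, ← mul_sum, ← mul_sum]
  have h1 := sum_inv_sub_sq_le hk
  have h2 : ∑ l ∈ (Icc 1 N).erase k, 1 / (l : ℝ) ^ 2 ≤ 2 :=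
    (sum_le_sum_of_subset_of_nonneg (erase_subset _ _) fun _ _ _ => by positivity).trans
      (sum_inv_sq_le N)
  calc _ ≤ T / 2500 * (3 / 2 * 4 + 1 / 2 * 2) := by gcongr
    _ = _ := by ring

/-- The case of frequencies with gaps at least `72`. With `w = cos² (πs)` the total interaction is at
most `0.0028` relative to the block size, and any `K > 1 / 2 + 0.0028` is admissible. -/
theorem separated_sum_div_le {N : ℕ} {μ : ℕ → ℝ} (hμ : StrictMonoOn μ (Set.Icc 1 N))
    (hsep : ∀ k ∈ Icc 1 N, ∀ l ∈ Icc 1 N, 72 * |(k : ℝ) - l| ≤ |μ k - μ l|) (a : ℕ → ℂ) :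
    1 / 122 * ∑ k ∈ Icc 1 N, ‖a k‖ / ((k : ℝ) + 1) ≤
      ∫ s in (-(1 / 2) : ℝ)..(1 / 2), ‖∑ k ∈ Icc 1 N, a k * ch (μ k * s)‖ := by
  have hone : ∀ {k l : ℕ}, k ≠ l → 1 ≤ |(k : ℝ) - l| := by
    intro k l hkl
    have : (1 : ℤ) ≤ |(k : ℤ) - l| := Int.one_le_abs (sub_ne_zero.mpr (by exact_mod_cast hkl))
    exact_mod_cast this
  have key := weighted_lower_bound (N := N) (J := blockIndex 3 N) (blk := blockIndex 3) (t := 1 / 2)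
    (ε := 1 / 4) (K := 0.51) (η := 0.0028) (μ := μ) (w := fun s => Real.cos (Real.pi * s) ^ 2)
    (δ := fun k l => 1 / (10000 * ((k : ℝ) - l) ^ 2)) a (by norm_num) (by norm_num) (by norm_num)
    (card_block_mul_pow_le (p := 3) (by norm_num) (by norm_num) N)
    (fun k l => lt_of_blockIndex_lt) (by fun_prop) (fun s => by positivity)
    (fun s => Real.cos_sq_le_one _) (fun k _ => ?_) (fun k hk l hl hkl => ?_)
    (fun k hk l hl hkl P M hP => ?_) (fun k hk => sum_interaction_le hk)
    (by rw [integral_cos_sq_pi]; norm_num)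
  · rw [integral_cos_sq_pi] at key
    have h := sum_div_succ_le (by norm_num)
      (intervalIntegral.integral_nonneg (by norm_num) fun s _ => norm_nonneg _) (by norm_num) key
    refine le_trans ?_ h
    gcongr
    norm_num
  · have h1 : Real.cos (Real.pi * -(1 / 2)) = 0 := by
      rw [show Real.pi * -(1 / 2) = -(Real.pi / 2) by ring, Real.cos_neg, Real.cos_pi_div_two]
    have h2 : Real.cos (Real.pi * (1 / 2)) = 0 := by
      rw [show Real.pi * (1 / 2) = Real.pi / 2 by ring, Real.cos_pi_div_two]
    rw [h1, h2]; simp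
  · have h1 := hone hkl
    have h2 := hsep k hk l hl
    refine (norm_integral_cos_sq_mul_ch_le (by linarith)).trans ?_
    rw [← sq_abs ((k : ℝ) - l), ← sq_abs (μ k - μ l)]
    set d := |(k : ℝ) - l|
    set x := |μ k - μ l|
    have h3 : 1 ≤ x := by linarith
    refine one_div_le_one_div_of_le (by positivity) ?_
    have h4 : 71 * d * d ≤ x ^ 2 - 1 := by nlinarith
    calc 10000 * d ^ 2 ≤ 6 * (72 * (71 * d * d)) := by nlinarith
      _ ≤ 6 * (x * (x ^ 2 - 1)) := by gcongr; linarith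
  · have h1 := hone hkl.ne'
    have h2 := hsep k hk l hl
    have hlt := hμ (by simpa using hl) (by simpa using hk) hkl
    rw [abs_of_pos (sub_pos.mpr hlt)] at h2
    refine (norm_integral_cos_sq_mul_polynomial_le (by linarith) hP).trans ?_
    have hM : 0 ≤ M := (norm_nonneg _).trans (hP 0 (by norm_num))
    refine mul_le_mul_of_nonneg_left ?_ hM
    rw [← sq_abs ((k : ℝ) - l)]
    set d := |(k : ℝ) - l|
    refine one_div_le_one_div_of_le (by positivity) ?_
    calc 10000 * d ^ 2 ≤ 12 * (72 * d * (71 * d)) := by nlinarith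
      _ ≤ 12 * ((μ k - μ l) * (μ k - μ l - 1)) := by gcongr; linarith

end Littlewood

theorem theorem1 (N : ℕ) (freq : ℕ → ℝ) (hfreq : StrictMonoOn freq (Set.Icc 1 N)) (a : ℕ → ℂ) :
    (∃ L : ℝ, Filter.Tendsto (absMean (trigPoly N freq a)) Filter.atTop (nhds L) ∧
      (1 / 26 : ℝ) * ∑ k ∈ Finset.Icc 1 N, ‖a k‖ / ((k : ℝ) + 1) ≤ L ∧
      ((∀ k ∈ Finset.Icc 1 N, 1 ≤ ‖a k‖) → 4 / Real.pi ^ 3 * Real.log (N : ℝ) ≤ L)) ∧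
    ((∀ k ∈ Finset.Icc 1 N, ∀ l ∈ Finset.Icc 1 N, |(k : ℝ) - (l : ℝ)| ≤ |freq k - freq l|) →
      ∀ T : ℝ, 72 ≤ T →
        (1 / 122 : ℝ) * ∑ k ∈ Finset.Icc 1 N, ‖a k‖ / ((k : ℝ) + 1) ≤
          absMean (trigPoly N freq a) T) := by
  constructor
  · obtain ⟨L, hL⟩ := Littlewood.exists_tendsto_absMean N freq a
    exact ⟨L, hL,
      Littlewood.le_of_tendsto_absMean hfreq hL fun n hn => Littlewood.integer_sum_div_le hn a,
      fun ha => Littlewood.le_of_tendsto_absMean hfreq hL fun n hn =>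
        Littlewood.integer_log_le hn ha⟩
  · intro hsep T hT
    have hT0 : 0 < T := by linarith
    rw [Littlewood.absMean_trigPoly_eq _ _ _ hT0]
    refine Littlewood.separated_sum_div_le (μ := fun k => T * freq k)
      (fun k hk l hl hkl => mul_lt_mul_of_pos_left (hfreq hk hl hkl) hT0) (fun k hk l hl => ?_) a
    rw [← mul_sub, abs_mul, abs_of_pos hT0]
    exact mul_le_mul hT (hsep k hk l hl) (abs_nonneg _) hT0.le
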